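/- Let $(M,g)$ be a nonempty smooth Riemannian manifold of dimension $n\ge 2$ and of constant sectional curvature $c$, and let $T^*_0M$ be its cotangent bundle with the zero section removed. In the chart $(q^i,p_i)$ of $T^*_0M$ induced by a chart of $M$, let $\Gamma^k_{ij}$ be the Christoffel symbols of $g$, and put $t=\tfrac12 g^{ik}p_ip_k$, $g^{0i}=p_hg^{hi}$, $\Gamma^0_{ij}=p_k\Gamma^k_{ij}$, $\frac{\delta}{\delta q^i}=\frac{\partial}{\partial q^i}+\Gamma^0_{ih}\frac{\partial}{\partial p_h}$ and $Dp_i=dp_i-\Gamma^0_{ij}dq^j$. Let $A>0$ be a real number and let $\lambda,\mu:(0,\infty)\to\mathbb R$ be smooth functions of $t$ such that, for all $t>0$, $$\lambda>0,\qquad \frac{2c-A^2t\lambda^2}{\lambda+2t\lambda'}>0,\qquad \lambda+2t\mu>0 .$$ Let $J$ be given by $J\frac{\delta}{\delta q^i}=J^{(1)}_{ij}\frac{\partial}{\partial p_j}$, $J\frac{\partial}{\partial p_i}=-J_{(2)}^{ij}\frac{\delta}{\delta q^j}$, where $$J^{(1)}_{ij}=At\lambda\, g_{ij}+\frac{c-A^2t\lambda(\lambda+t\lambda')}{At(\lambda+2t\lambda')}\,p_ip_j,\qquad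 J_{(2)}^{ij}=\frac{1}{At\lambda}\,g^{ij}-\frac{c-A^2t\lambda(\lambda+t\lambda')}{At^2\lambda(2c-A^2t\lambda^2)}\,g^{0i}g^{0j},$$ and let $G=G^{(1)}_{ij}dq^idq^j+G_{(2)}^{ij}Dp_iDp_j$, where $$G^{(1)}_{ij}=At\lambda^2 g_{ij}+\frac{\lambda[c-A^2t\lambda(\lambda+t\lambda')]+\mu t(2c-A^2t\lambda^2)}{At(\lambda+2t\lambda')}\,p_ip_j,$$ $$G_{(2)}^{ij}=\frac{1}{At}\,g^{ij}+\frac{-c+A^2t\lambda(\lambda+t\lambda')+\mu A^2t^2(\lambda+2t\lambda')}{At^2(2c-A^2t\lambda^2)}\,g^{0i}g^{0j}.$$ Then $(G,J)$ is a Hermitian structure on $T^*_0M$ (with $J$ integrable). It is Kähler, i.e. its fundamental $2$-form $\phi(X,Y)=G(X,JY)$ is closed, if and only if $\mu(t)=\lambda'(t)$ for all $t>0$. Moreover $$d\phi=(\lambda'-\mu)\,g^{0h}\,Dp_h\wedge Dp_i\wedge dq^i ,$$ where $d$ and $\wedge$ are normalized without numerical factors, so that $(\alpha\wedge\beta)(X,Y)=\alpha(X)\beta(Y)-\alpha(Y)\beta(X)$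 and $d\alpha(X,Y)=X\alpha(Y)-Y\alpha(X)-\alpha([X,Y])$. -/

import Mathlib

open scoped Manifold ContDiff Matrix

noncomputable section

namespace NaturalCotangent

/-- Coordinates `(q, p) = (q¹, …, qⁿ, p₁, …, pₙ)` of an induced chart of the cotangent bundle. -/
abbrev Phase (n : ℕ) : Type := EuclideanSpace ℝ (Fin n) × (Fin n → ℝ)

/-- Local charts of `M`. -/
abbrev Chart (n : ℕ) (M : Type*) [TopologicalSpace M] : Type _ :=
  OpenPartialHomeomorph M (EuclideanSpace ℝ (Fin n))

/-- Smooth Riemannian metrics on `M`. -/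
abbrev Metric (n : ℕ) (M : Type*) [TopologicalSpace M]
    [ChartedSpace (EuclideanSpace ℝ (Fin n)) M] [IsManifold (𝓡 n) ∞ M] : Type _ :=
  Bundle.ContMDiffRiemannianMetric (𝓡 n) ∞ (EuclideanSpace ℝ (Fin n))
    (fun x : M => TangentSpace (𝓡 n) x)

/-! ### Partial derivatives on `ℝⁿ` -/

/-- The `i`-th standard basis vector of `ℝⁿ`. -/
def stdVec {n : ℕ} (i : Fin n) : EuclideanSpace ℝ (Fin n) := EuclideanSpace.single i 1

/-- `∂f/∂xⁱ` at `q`. -/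
def pderiv {n : ℕ} (i : Fin n) (f : EuclideanSpace ℝ (Fin n) → ℝ)
    (q : EuclideanSpace ℝ (Fin n)) : ℝ :=
  fderiv ℝ f q (stdVec i)

section Base

variable {n : ℕ} {M : Type*} [TopologicalSpace M] [ChartedSpace (EuclideanSpace ℝ (Fin n)) M]

/-- The coordinate vector field `∂/∂xⁱ` of the chart `e`, at the point with coordinates `q`. -/
def coordVec (e : Chart n M) (q : EuclideanSpace ℝ (Fin n)) (i : Fin n) :
    TangentSpace (𝓡 n) (e.symm q) :=
  mfderiv (𝓡 n) (𝓡 n) e.symm q (stdVec i)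

/-- The image of the nonzero cotangent bundle (over the domain of `e`) under the chart induced
by `e`: the coordinates of a covector `P ≠ 0` at `x` are `qⁱ = xⁱ(x)` and `pᵢ = P(∂/∂xⁱ)`. -/
def inducedTarget (e : Chart n M) : Set (Phase n) :=
  {z | z.1 ∈ e.target ∧ ∃ P : TangentSpace (𝓡 n) (e.symm z.1) →L[ℝ] ℝ,
    P ≠ 0 ∧ ∀ i, z.2 i = P (coordVec e z.1 i)}

/-- The change of coordinates `(q, p) ↦ (q', p')`, `p'ᵢ = pₖ ∂qᵏ/∂q'ⁱ`, between the charts of the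
cotangent bundle that are induced by `e` and `e'`. -/
def inducedTransition (e e' : Chart n M) (z : Phase n) : Phase n :=
  (e' (e.symm z.1),
    fun i => ∑ k, z.2 k * pderiv i (fun y => e (e'.symm y) k) (e' (e.symm z.1)))

variable [IsManifold (𝓡 n) ∞ M]

/-- The matrix `g_{ij}` of the metric in the chart `e`. -/
def gLow (g : Metric n M) (e : Chart n M) (q : EuclideanSpace ℝ (Fin n)) :
    Matrix (Fin n) (Fin n) ℝ :=
  Matrix.of fun i j => g.inner (e.symm q) (coordVec e q i) (coordVec e q j)

/-- The inverse matrix `g^{ij}`. -/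
def gUp (g : Metric n M) (e : Chart n M) (q : EuclideanSpace ℝ (Fin n)) :
    Matrix (Fin n) (Fin n) ℝ :=
  (gLow g e q)⁻¹

/-- The Christoffel symbols `Γ^k_{ij}` of the Levi-Civita connection. -/
def christoffel (g : Metric n M) (e : Chart n M) (k i j : Fin n)
    (q : EuclideanSpace ℝ (Fin n)) : ℝ :=
  (1 / 2) * ∑ l, gUp g e q k l *
    (pderiv i (fun y => gLow g e y j l) q + pderiv j (fun y => gLow g e y i l) q
      - pderiv l (fun y => gLow g e y i j) q)

/-- The curvature components `R^l_{kij}`, where `R(∂ᵢ, ∂ⱼ)∂ₖ = R^l_{kij} ∂ₗ`. -/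
def curvature (g : Metric n M) (e : Chart n M) (l k i j : Fin n)
    (q : EuclideanSpace ℝ (Fin n)) : ℝ :=
  pderiv i (christoffel g e l j k) q - pderiv j (christoffel g e l i k) q
    + ∑ m, (christoffel g e l i m q * christoffel g e m j k q
      - christoffel g e l j m q * christoffel g e m i k q)

/-- The inner product of the tangent vectors `Xⁱ ∂ᵢ` and `Yⁱ ∂ᵢ`. -/
def innerCoord (g : Metric n M) (e : Chart n M) (q : EuclideanSpace ℝ (Fin n))
    (X Y : Fin n → ℝ) : ℝ :=
  ∑ i, ∑ j, gLow g e q i j * X i * Y j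

/-- The components of the vector `R(X, Y)Z`. -/
def curvatureVec (g : Metric n M) (e : Chart n M) (q : EuclideanSpace ℝ (Fin n))
    (X Y Z : Fin n → ℝ) : Fin n → ℝ :=
  fun l => ∑ i, ∑ j, ∑ k, curvature g e l k i j q * X i * Y j * Z k

/-- All sectional curvatures are equal to `c`:
`⟨R(X, Y)Y, X⟩ = c (|X|² |Y|² - ⟨X, Y⟩²)` for all tangent vectors `X, Y` at all points. -/
def HasConstantSectionalCurvature (g : Metric n M) (c : ℝ) : Prop :=
  ∀ e ∈ IsManifold.maximalAtlas (𝓡 n) ∞ M, ∀ q ∈ e.target, ∀ X Y : Fin n → ℝ,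
    innerCoord g e q (curvatureVec g e q X Y Y) X =
      c * (innerCoord g e q X X * innerCoord g e q Y Y - innerCoord g e q X Y ^ 2)

/-! ### The cotangent bundle in induced charts -/

/-- The energy density `t = ½ g^{ik} pᵢ pₖ`. -/
def energy (g : Metric n M) (e : Chart n M) (z : Phase n) : ℝ :=
  (1 / 2) * ∑ i, ∑ k, gUp g e z.1 i k * z.2 i * z.2 k

/-- `g^{0i} = p_h g^{hi}`. -/
def gZero (g : Metric n M) (e : Chart n M) (z : Phase n) (i : Fin n) : ℝ :=
  ∑ h, z.2 h * gUp g e z.1 h i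

/-- `Γ^0_{ij} = p_k Γ^k_{ij}`. -/
def christoffelZero (g : Metric n M) (e : Chart n M) (z : Phase n) (i j : Fin n) : ℝ :=
  ∑ k, z.2 k * christoffel g e k i j z.1

/-- The vertical vector field `∂/∂pᵢ`. -/
def partialP (i : Fin n) : Phase n := (0, Pi.single i 1)

/-- The horizontal vector field `δ/δqⁱ = ∂/∂qⁱ + Γ^0_{ih} ∂/∂p_h`. -/
def deltaQ (g : Metric n M) (e : Chart n M) (z : Phase n) (i : Fin n) : Phase n :=
  (stdVec i, fun h => christoffelZero g e z i h)

/-- The `1`-form `dqⁱ`. -/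
def dq (i : Fin n) : Phase n →L[ℝ] ℝ :=
  (EuclideanSpace.proj i : EuclideanSpace ℝ (Fin n) →L[ℝ] ℝ).comp
    (ContinuousLinearMap.fst ℝ (EuclideanSpace ℝ (Fin n)) (Fin n → ℝ))

/-- The `1`-form `dpᵢ`. -/
def dp (i : Fin n) : Phase n →L[ℝ] ℝ :=
  (ContinuousLinearMap.proj i : (Fin n → ℝ) →L[ℝ] ℝ).comp
    (ContinuousLinearMap.snd ℝ (EuclideanSpace ℝ (Fin n)) (Fin n → ℝ))

/-- The `1`-form `Dpᵢ = dpᵢ - Γ^0_{ij} dqʲ`. -/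
def covDp (g : Metric n M) (e : Chart n M) (z : Phase n) (i : Fin n) : Phase n →L[ℝ] ℝ :=
  dp i - ∑ j, christoffelZero g e z i j • dq j

/-! ### The natural structures of diagonal type -/

/-- `J^{(1)}_{ij} = a₁ g_{ij} + b₁ pᵢ pⱼ` with `a₁ = A t λ`,
`b₁ = (c - A² t λ (λ + t λ')) / (A t (λ + 2 t λ'))`. -/
def J1 (g : Metric n M) (A c : ℝ) (lam : ℝ → ℝ) (e : Chart n M) (z : Phase n)
    (i j : Fin n) : ℝ :=
  let t := energy g e z
  let l := lam t
  let l' := deriv lam t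
  A * t * l * gLow g e z.1 i j
    + (c - A ^ 2 * t * l * (l + t * l')) / (A * t * (l + 2 * t * l')) * z.2 i * z.2 j

/-- `J_{(2)}^{ij} = a₂ g^{ij} + b₂ g^{0i} g^{0j}` with `a₂ = 1 / (A t λ)`,
`b₂ = -(c - A² t λ (λ + t λ')) / (A t² λ (2c - A² t λ²))`. -/
def J2 (g : Metric n M) (A c : ℝ) (lam : ℝ → ℝ) (e : Chart n M) (z : Phase n)
    (i j : Fin n) : ℝ :=
  let t := energy g e z
  let l := lam t
  let l' := deriv lam t
  1 / (A * t * l) * gUp g e z.1 i j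
    - (c - A ^ 2 * t * l * (l + t * l')) / (A * t ^ 2 * l * (2 * c - A ^ 2 * t * l ^ 2))
      * gZero g e z i * gZero g e z j

/-- `G^{(1)}_{ij} = c₁ g_{ij} + d₁ pᵢ pⱼ` with `c₁ = A t λ²`,
`d₁ = (λ (c - A² t λ (λ + t λ')) + μ t (2c - A² t λ²)) / (A t (λ + 2 t λ'))`. -/
def G1 (g : Metric n M) (A c : ℝ) (lam mu : ℝ → ℝ) (e : Chart n M) (z : Phase n)
    (i j : Fin n) : ℝ :=
  let t := energy g e z
  let l := lam t
  let l' := deriv lam t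
  A * t * l ^ 2 * gLow g e z.1 i j
    + (l * (c - A ^ 2 * t * l * (l + t * l')) + mu t * t * (2 * c - A ^ 2 * t * l ^ 2))
      / (A * t * (l + 2 * t * l')) * z.2 i * z.2 j

/-- `G_{(2)}^{ij} = c₂ g^{ij} + d₂ g^{0i} g^{0j}` with `c₂ = 1 / (A t)`,
`d₂ = (-c + A² t λ (λ + t λ') + μ A² t² (λ + 2 t λ')) / (A t² (2c - A² t λ²))`. -/
def G2 (g : Metric n M) (A c : ℝ) (lam mu : ℝ → ℝ) (e : Chart n M) (z : Phase n)
    (i j : Fin n) : ℝ :=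
  let t := energy g e z
  let l := lam t
  let l' := deriv lam t
  1 / (A * t) * gUp g e z.1 i j
    + (-c + A ^ 2 * t * l * (l + t * l') + mu t * A ^ 2 * t ^ 2 * (l + 2 * t * l'))
      / (A * t ^ 2 * (2 * c - A ^ 2 * t * l ^ 2)) * gZero g e z i * gZero g e z j

/-- The almost complex structure with `J(δ/δqⁱ) = J^{(1)}_{ij} ∂/∂pⱼ` and
`J(∂/∂pᵢ) = -J_{(2)}^{ij} δ/δqʲ`, in the chart induced by `e`. -/
def natJ (g : Metric n M) (A c : ℝ) (lam : ℝ → ℝ) (e : Chart n M) (z : Phase n) :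
    Phase n →L[ℝ] Phase n :=
  ∑ i, ∑ j, (J1 g A c lam e z i j • (dq i).smulRight (partialP j)
    - J2 g A c lam e z i j • (covDp g e z i).smulRight (deltaQ g e z j))

/-- The metric `G = G^{(1)}_{ij} dqⁱ dqʲ + G_{(2)}^{ij} Dpᵢ Dpⱼ`, in the chart induced by `e`. -/
def natG (g : Metric n M) (A c : ℝ) (lam mu : ℝ → ℝ) (e : Chart n M) (z : Phase n) :
    Phase n →L[ℝ] Phase n →L[ℝ] ℝ :=
  ∑ i, ∑ j, (G1 g A c lam mu e z i j • (dq i).smulRight (dq j)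
    + G2 g A c lam mu e z i j • (covDp g e z i).smulRight (covDp g e z j))

/-- The value at `(u, v, w)` of the `3`-form `g^{0h} Dp_h ∧ Dpᵢ ∧ dqⁱ`, with the convention
`(α ∧ β ∧ γ)(u, v, w) = det` of the values of `α, β, γ` on `u, v, w`. -/
def threeForm (g : Metric n M) (e : Chart n M) (z u v w : Phase n) : ℝ :=
  ∑ h, ∑ i, gZero g e z h *
    Matrix.det !![covDp g e z h u, covDp g e z h v, covDp g e z h w;
                  covDp g e z i u, covDp g e z i v, covDp g e z i w;
                  dq i u, dq i v, dq i w]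

end Base

/-! ### Hermitian and Kähler structures -/

/-- The Nijenhuis tensor `N(X, Y) = [JX, JY] - J[JX, Y] - J[X, JY] - [X, Y]`. -/
def nijenhuis {V : Type*} [NormedAddCommGroup V] [NormedSpace ℝ V] (J : V → V →L[ℝ] V)
    (X Y : V → V) (z : V) : V :=
  VectorField.lieBracket ℝ (fun y => J y (X y)) (fun y => J y (Y y)) z
    - J z (VectorField.lieBracket ℝ (fun y => J y (X y)) Y z)
    - J z (VectorField.lieBracket ℝ X (fun y => J y (Y y)) z)
    - VectorField.lieBracket ℝ X Y z

/-- `(G, J)` is a Hermitian structure on the open set `D`: `J` is an integrable almost complex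
structure and `G` a Riemannian metric with `G(JX, JY) = G(X, Y)`. -/
structure IsHermitianOn {V : Type*} [NormedAddCommGroup V] [NormedSpace ℝ V] (D : Set V)
    (G : V → V →L[ℝ] V →L[ℝ] ℝ) (J : V → V →L[ℝ] V) : Prop where
  smooth_J : ContDiffOn ℝ ∞ J D
  smooth_G : ContDiffOn ℝ ∞ G D
  sq_eq : ∀ z ∈ D, ∀ v, J z (J z v) = -v
  integrable : ∀ X Y : V → V, ContDiffOn ℝ ∞ X D → ContDiffOn ℝ ∞ Y D →
    ∀ z ∈ D, nijenhuis J X Y z = 0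
  symm : ∀ z ∈ D, ∀ u v, G z u v = G z v u
  pos : ∀ z ∈ D, ∀ v, v ≠ 0 → 0 < G z v v
  compatible : ∀ z ∈ D, ∀ u v, G z (J z u) (J z v) = G z u v

/-- `φ` is the fundamental `2`-form `φ(X, Y) = G(X, JY)` on `D`. -/
def IsFundamentalForm {V : Type*} [NormedAddCommGroup V] [NormedSpace ℝ V] (D : Set V)
    (G : V → V →L[ℝ] V →L[ℝ] ℝ) (J : V → V →L[ℝ] V) (φ : V → V [⋀^Fin 2]→L[ℝ] ℝ) : Prop :=
  ContDiffOn ℝ ∞ φ D ∧ ∀ z ∈ D, ∀ u v, φ z ![u, v] = G z u (J z v)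

section Global

variable {n : ℕ} {M : Type*} [TopologicalSpace M] [ChartedSpace (EuclideanSpace ℝ (Fin n)) M]

/-- `(G, J)`, given by components in the induced charts, is a Hermitian structure on the nonzero
cotangent bundle of `M`: the components obey the transformation laws of tensor fields of types
`(0, 2)` and `(1, 1)`, and they form a Hermitian structure in every induced chart. -/
structure IsHermitianStructure (G : Chart n M → Phase n → Phase n →L[ℝ] Phase n →L[ℝ] ℝ)
    (J : Chart n M → Phase n → Phase n →L[ℝ] Phase n) : Prop where
  transform_G : ∀ e ∈ IsManifold.maximalAtlas (𝓡 n) ∞ M,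
    ∀ e' ∈ IsManifold.maximalAtlas (𝓡 n) ∞ M,
    ∀ z ∈ inducedTarget e, e.symm z.1 ∈ e'.source → ∀ u v,
      G e' (inducedTransition e e' z) (fderiv ℝ (inducedTransition e e') z u)
        (fderiv ℝ (inducedTransition e e') z v) = G e z u v
  transform_J : ∀ e ∈ IsManifold.maximalAtlas (𝓡 n) ∞ M,
    ∀ e' ∈ IsManifold.maximalAtlas (𝓡 n) ∞ M,
    ∀ z ∈ inducedTarget e, e.symm z.1 ∈ e'.source → ∀ v,
      J e' (inducedTransition e e' z) (fderiv ℝ (inducedTransition e e') z v) =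
        fderiv ℝ (inducedTransition e e') z (J e z v)
  hermitian : ∀ e ∈ IsManifold.maximalAtlas (𝓡 n) ∞ M,
    IsHermitianOn (inducedTarget e) (G e) (J e)

/-- `(G, J)` is a Kähler structure on the nonzero cotangent bundle of `M`: a Hermitian structure
whose fundamental `2`-form is closed. -/
structure IsKahlerStructure (G : Chart n M → Phase n → Phase n →L[ℝ] Phase n →L[ℝ] ℝ)
    (J : Chart n M → Phase n → Phase n →L[ℝ] Phase n) : Prop where
  isHermitian : IsHermitianStructure G J
  closed : ∀ e ∈ IsManifold.maximalAtlas (𝓡 n) ∞ M,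
    ∃ φ, IsFundamentalForm (inducedTarget e) (G e) (J e) φ ∧
      ∀ z ∈ inducedTarget e, extDeriv φ z = 0

end Global

end NaturalCotangent

end

/-!
# Kähler structures of natural diagonal type on the nonzero cotangent bundle

Write a tangent vector of `T*₀M` in the adapted frame, with horizontal components `x = dq(v)` and
vertical components `ξ = Dp(v)`. There `J` is `(x, ξ) ↦ (-Tξ, Sx)`, where `S = J⁽¹⁾` and
`T = J₍₂₎` are combinations of `g`, `p ⊗ p` and of `g⁻¹`, `p♯ ⊗ p♯`, with coefficients that depend on
the energy density `t`. All pointwise claims are identities between these coefficients: `S T = 1`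
(so `J² = -1`), and `G₍₂₎ S = λ + μ p♯ ⊗ p`, `G⁽¹⁾ = S G₍₂₎ S` (so `G` is compatible with `J`).
With `G⁽¹⁾ = c₁ g + d₁ p ⊗ p` and `G₍₂₎ = c₂ g⁻¹ + d₂ p♯ ⊗ p♯`, positivity of `G` is the
Cauchy-Schwarz inequality together with the positivity of `c₁, c₂`, `c₁ + 2t d₁` and `c₂ + 2t d₂`.

*Integrability.* The Nijenhuis tensor is tensorial and `J`-antilinear, and every vector is `X + JY`
with `X, Y` horizontal, so it suffices to evaluate it on the fields `δᵢ = δ/δqⁱ`. The mixed brackets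
cancel, `[Jδᵢ, δⱼ] + [δᵢ, Jδⱼ] = 0`, because `g`, `p` and `t` are parallel (`lieBracket_mixed`).
In constant curvature `[δᵢ, δⱼ] = c (pᵢ g_{jk} - pⱼ g_{ik}) ∂/∂pₖ` (`lieBracket_deltaQ`), and
with `S = a₁ g + b₁ p ⊗ p` the bracket `[Jδᵢ, Jδⱼ]` is the same expression with `c` replaced by
`(a₁ + 2t b₁) a₁' - a₁ b₁` (`lieBracket_vertical`); the coefficient `b₁` is chosen such that this
number is `c` (`coeff_integrability`). The form of the curvature tensor follows from the sectional
curvatures by polarization, which needs the algebraic symmetries of the curvature tensor.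

*The fundamental form.* From `G₍₂₎ S = λ + μ p♯ ⊗ p` and `dt = g^{0h} Dp_h` one reads off
`φ = λ(t) ω + μ(t) dt ∧ θ` with `θ = pᵢ dqⁱ` and `ω = dpᵢ ∧ dqⁱ = dθ`. Hence
`dφ = λ' dt ∧ ω - μ dt ∧ ω`. In dimension at least `2` the form `dt ∧ ω` vanishes nowhere, and `t`
takes all positive values, so `φ` is closed if and only if `μ = λ'`.

*Independence of the chart.* The Christoffel symbols transform as expected because the
Levi-Civita connection is the only torsion free metric connection (`christoffel_unique`,
`jac_mul_connMatrix`); hence the forms `Dpᵢ` transform as covectors, and `G` and `J` as tensors.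
-/

noncomputable section

namespace NaturalCotangent

/-! ### The metric in a chart -/

section Manifold

variable {n : ℕ} {M : Type*} [TopologicalSpace M] [ChartedSpace (EuclideanSpace ℝ (Fin n)) M]

/-- The Jacobian matrix `∂q'ᵃ/∂qⁱ` of the change of charts `e' ∘ e⁻¹`. -/
def jac (e e' : Chart n M) (q : EuclideanSpace ℝ (Fin n)) : Matrix (Fin n) (Fin n) ℝ :=
  Matrix.of fun a i => pderiv i (fun y => e' (e.symm y) a) q

lemma sum_smul_stdVec (x : EuclideanSpace ℝ (Fin n)) : ∑ i, x i • (stdVec i) = x := by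
  ext j
  simp [stdVec, Pi.single_apply]

lemma sum_smul_coordVec (e : Chart n M) (q v : EuclideanSpace ℝ (Fin n)) :
    (∑ i, v i • coordVec e q i : TangentSpace (𝓡 n) (e.symm q)) =
      mfderiv (𝓡 n) (𝓡 n) e.symm q v := by
  conv_rhs => rw [← sum_smul_stdVec v]
  refine Eq.trans ?_ (map_sum (mfderiv (𝓡 n) (𝓡 n) e.symm q) _ _).symm
  exact Finset.sum_congr rfl fun i _ => ((mfderiv (𝓡 n) (𝓡 n) e.symm q).map_smul _ _).symm

lemma contDiffOn_trans {e e' : Chart n M} (he : e ∈ IsManifold.maximalAtlas (𝓡 n) ∞ M)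
    (he' : e' ∈ IsManifold.maximalAtlas (𝓡 n) ∞ M) :
    ContDiffOn ℝ ∞ (fun y => e' (e.symm y)) (e.symm.trans e').source := by
  rw [← contMDiffOn_iff_contDiffOn]
  refine (contMDiffOn_of_mem_maximalAtlas he').comp
    ((contMDiffOn_symm_of_mem_maximalAtlas he).mono ?_) ?_
  · intro y hy
    exact hy.1
  · intro y hy
    exact hy.2

lemma mdifferentiable_of_mem_maximalAtlas {e : Chart n M}
    (he : e ∈ IsManifold.maximalAtlas (𝓡 n) ∞ M) : e.MDifferentiable (𝓡 n) (𝓡 n) :=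
  ⟨(contMDiffOn_of_mem_maximalAtlas he).mdifferentiableOn (by simp),
    (contMDiffOn_symm_of_mem_maximalAtlas he).mdifferentiableOn (by simp)⟩

lemma contDiffAt_trans {e e' : Chart n M} (he : e ∈ IsManifold.maximalAtlas (𝓡 n) ∞ M)
    (he' : e' ∈ IsManifold.maximalAtlas (𝓡 n) ∞ M) {q : EuclideanSpace ℝ (Fin n)}
    (hq : q ∈ e.target) (hq' : e.symm q ∈ e'.source) :
    ContDiffAt ℝ ∞ (fun y => e' (e.symm y)) q :=
  (contDiffOn_trans he he').contDiffAt ((e.symm.trans e').open_source.mem_nhds ⟨hq, hq'⟩)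

lemma jac_eq_fderiv {e e' : Chart n M} (he : e ∈ IsManifold.maximalAtlas (𝓡 n) ∞ M)
    (he' : e' ∈ IsManifold.maximalAtlas (𝓡 n) ∞ M) {q : EuclideanSpace ℝ (Fin n)}
    (hq : q ∈ e.target) (hq' : e.symm q ∈ e'.source) (a i : Fin n) :
    jac e e' q a i = fderiv ℝ (fun y => e' (e.symm y)) q (stdVec i) a := by
  have h := (contDiffAt_trans he he' hq hq').differentiableAt (by simp)
  have := ((EuclideanSpace.proj a : EuclideanSpace ℝ (Fin n) →L[ℝ] ℝ).hasFDerivAt.comp q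
    h.hasFDerivAt).fderiv
  simp only [jac, pderiv, Matrix.of_apply]
  exact congrArg (fun L => L (stdVec i)) this

lemma fderiv_trans_apply {e e' : Chart n M} (he : e ∈ IsManifold.maximalAtlas (𝓡 n) ∞ M)
    (he' : e' ∈ IsManifold.maximalAtlas (𝓡 n) ∞ M) {q : EuclideanSpace ℝ (Fin n)}
    (hq : q ∈ e.target) (hq' : e.symm q ∈ e'.source) (v : EuclideanSpace ℝ (Fin n)) (a : Fin n) :
    fderiv ℝ (fun y => e' (e.symm y)) q v a = ∑ i, jac e e' q a i * v i := by
  conv_lhs => rw [← sum_smul_stdVec v, map_sum]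
  simp [jac_eq_fderiv he he' hq hq', mul_comm]

/-- The derivative of `e⁻¹` is the derivative of `e'⁻¹` after that of `e' ∘ e⁻¹`. -/
lemma mfderiv_symm_eq {e e' : Chart n M} (he : e ∈ IsManifold.maximalAtlas (𝓡 n) ∞ M)
    (he' : e' ∈ IsManifold.maximalAtlas (𝓡 n) ∞ M) {q : EuclideanSpace ℝ (Fin n)}
    (hq : q ∈ e.target) (hq' : e.symm q ∈ e'.source) (v : EuclideanSpace ℝ (Fin n)) :
    (mfderiv (𝓡 n) (𝓡 n) e.symm q v : EuclideanSpace ℝ (Fin n)) =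
      mfderiv (𝓡 n) (𝓡 n) e'.symm (e' (e.symm q))
        (fderiv ℝ (fun y => e' (e.symm y)) q v : EuclideanSpace ℝ (Fin n)) := by
  have h1 : MDifferentiableAt (𝓡 n) (𝓡 n) (fun y => e' (e.symm y)) q :=
    ((contDiffAt_trans he he' hq hq').differentiableAt (by simp)).mdifferentiableAt
  have h2 : MDifferentiableAt (𝓡 n) (𝓡 n) e'.symm (e' (e.symm q)) :=
    (mdifferentiable_of_mem_maximalAtlas he').mdifferentiableAt_symm (e'.map_source hq')
  have h3 := mfderiv_comp q h2 h1
  have h4 : e.symm =ᶠ[nhds q] e'.symm ∘ (fun y => e' (e.symm y)) := by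
    filter_upwards [(e.symm.trans e').open_source.mem_nhds ⟨hq, hq'⟩] with y hy
    exact (e'.left_inv hy.2).symm
  have h5 := h4.mfderiv_eq (I := 𝓡 n) (I' := 𝓡 n)
  rw [mfderiv_eq_fderiv] at h3
  exact congrArg (fun L : EuclideanSpace ℝ (Fin n) →L[ℝ] EuclideanSpace ℝ (Fin n) => L v)
    (h5.trans h3)

lemma mfderiv_symm_injective {e : Chart n M} (he : e ∈ IsManifold.maximalAtlas (𝓡 n) ∞ M)
    {q : EuclideanSpace ℝ (Fin n)} (hq : q ∈ e.target) {v : EuclideanSpace ℝ (Fin n)}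
    (hv : (mfderiv (𝓡 n) (𝓡 n) e.symm q v : EuclideanSpace ℝ (Fin n)) = 0) : v = 0 := by
  have h := (mdifferentiable_of_mem_maximalAtlas he).comp_symm_deriv hq
  have h1 : mfderiv (𝓡 n) (𝓡 n) e (e.symm q) (mfderiv (𝓡 n) (𝓡 n) e.symm q v) = v :=
    congrArg (fun L : EuclideanSpace ℝ (Fin n) →L[ℝ] EuclideanSpace ℝ (Fin n) => L v) h
  rw [← h1]
  exact (congrArg (mfderiv (𝓡 n) (𝓡 n) e (e.symm q)) hv).trans (map_zero _)

/-- A covector is nonzero if and only if its coordinates are not all zero, and all coordinates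
occur. -/
lemma mem_inducedTarget_iff {e : Chart n M} (he : e ∈ IsManifold.maximalAtlas (𝓡 n) ∞ M)
    (z : Phase n) : z ∈ inducedTarget e ↔ z.1 ∈ e.target ∧ z.2 ≠ 0 := by
  constructor
  · rintro ⟨h1, P, hP, h⟩
    refine ⟨h1, fun h0 => hP ?_⟩
    have h' := (mdifferentiable_of_mem_maximalAtlas he).symm_comp_deriv (e.map_target h1)
    rw [e.right_inv h1] at h'
    ext v
    set w : EuclideanSpace ℝ (Fin n) := mfderiv (𝓡 n) (𝓡 n) e (e.symm z.1) v with hw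
    have h2 : (mfderiv (𝓡 n) (𝓡 n) e.symm z.1 w : EuclideanSpace ℝ (Fin n)) = v :=
      congrArg (fun L : EuclideanSpace ℝ (Fin n) →L[ℝ] EuclideanSpace ℝ (Fin n) => L v) h'
    have h3 := sum_smul_coordVec e z.1 w
    have h4 : P v = P (∑ i, w i • coordVec e z.1 i) := by
      rw [h3]; exact congrArg P h2.symm
    rw [h4, map_sum]
    simp [← h, h0]
  · rintro ⟨h1, h0⟩
    have h' := (mdifferentiable_of_mem_maximalAtlas he).comp_symm_deriv h1
    let L : EuclideanSpace ℝ (Fin n) →L[ℝ] ℝ := ∑ i, z.2 i • EuclideanSpace.proj i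
    let D : TangentSpace (𝓡 n) (e.symm z.1) →L[ℝ] EuclideanSpace ℝ (Fin n) :=
      mfderiv (𝓡 n) (𝓡 n) e (e.symm z.1)
    have key : ∀ i, (L.comp D) (coordVec e z.1 i) = z.2 i := by
      intro i
      have : D (coordVec e z.1 i) = stdVec i :=
        congrArg (fun L : EuclideanSpace ℝ (Fin n) →L[ℝ] EuclideanSpace ℝ (Fin n) => L (stdVec i)) h'
      rw [ContinuousLinearMap.comp_apply, this]
      simp [L, stdVec]
    refine ⟨h1, L.comp D, fun hP => h0 ?_, fun i => (key i).symm⟩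
    ext i
    rw [← key i, hP]
    rfl

lemma isOpen_inducedTarget {e : Chart n M} (he : e ∈ IsManifold.maximalAtlas (𝓡 n) ∞ M) :
    IsOpen (inducedTarget e) := by
  have : inducedTarget e = (Prod.fst ⁻¹' e.target) ∩ (Prod.snd ⁻¹' {0}ᶜ : Set (Phase n)) := by
    ext z
    exact mem_inducedTarget_iff he z
  rw [this]
  exact (e.open_target.preimage continuous_fst).inter
    (isOpen_compl_singleton.preimage continuous_snd)

lemma jac_mul_jac {e e' : Chart n M} (he : e ∈ IsManifold.maximalAtlas (𝓡 n) ∞ M)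
    (he' : e' ∈ IsManifold.maximalAtlas (𝓡 n) ∞ M) {q : EuclideanSpace ℝ (Fin n)}
    (hq : q ∈ e.target) (hq' : e.symm q ∈ e'.source) :
    jac e' e (e' (e.symm q)) * jac e e' q = 1 := by
  have hF := (contDiffAt_trans he he' hq hq').differentiableAt (by simp)
  have hq1 : e' (e.symm q) ∈ e'.target := e'.map_source hq'
  have hq2 : e'.symm (e' (e.symm q)) ∈ e.source := by
    rw [e'.left_inv hq']; exact e.map_target hq
  have hK := (contDiffAt_trans he' he hq1 hq2).differentiableAt (by simp)
  have h := (hK.hasFDerivAt.comp q hF.hasFDerivAt).fderiv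
  have h4 : ((fun y => e (e'.symm y)) ∘ fun y => e' (e.symm y)) =ᶠ[nhds q] id := by
    filter_upwards [(e.symm.trans e').open_source.mem_nhds ⟨hq, hq'⟩] with y hy
    exact (congrArg e (e'.left_inv hy.2)).trans (e.right_inv hy.1)
  rw [h4.fderiv_eq, fderiv_id] at h
  ext i j
  have h5 := congrArg (fun L : EuclideanSpace ℝ (Fin n) →L[ℝ] EuclideanSpace ℝ (Fin n) =>
    L (stdVec j) i) h
  simp only [ContinuousLinearMap.comp_apply, ContinuousLinearMap.id_apply] at h5
  rw [fderiv_trans_apply he' he hq1 hq2] at h5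
  simp only [Matrix.mul_apply, jac_eq_fderiv he he' hq hq']
  rw [← h5]
  simp [stdVec, Matrix.one_apply]

variable [IsManifold (𝓡 n) ∞ M] (g : Metric n M)

lemma gLow_symm (e : Chart n M) (q : EuclideanSpace ℝ (Fin n)) (i j : Fin n) :
    gLow g e q i j = gLow g e q j i :=
  g.symm _ _ _

lemma gLow_transpose (e : Chart n M) (q : EuclideanSpace ℝ (Fin n)) :
    (gLow g e q)ᵀ = gLow g e q := by
  ext i j
  exact gLow_symm g e q j i

lemma dotProduct_gLow (e : Chart n M) (q x y : EuclideanSpace ℝ (Fin n)) :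
    x.ofLp ⬝ᵥ gLow g e q *ᵥ y.ofLp = g.inner (e.symm q) (mfderiv (𝓡 n) (𝓡 n) e.symm q x)
      (mfderiv (𝓡 n) (𝓡 n) e.symm q y) := by
  rw [← sum_smul_coordVec e q x, ← sum_smul_coordVec e q y]
  simp only [map_sum, map_smul, sum_apply, smul_apply,
    dotProduct, Matrix.mulVec, smul_eq_mul, gLow, Matrix.of_apply, Finset.mul_sum]
  rw [Finset.sum_comm]
  exact Finset.sum_congr rfl fun i _ => Finset.sum_congr rfl fun j _ => by ring

lemma gLow_pos {e : Chart n M} (he : e ∈ IsManifold.maximalAtlas (𝓡 n) ∞ M)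
    {q : EuclideanSpace ℝ (Fin n)} (hq : q ∈ e.target) {x : Fin n → ℝ} (hx : x ≠ 0) :
    0 < x ⬝ᵥ gLow g e q *ᵥ x := by
  have := dotProduct_gLow g e q (WithLp.toLp 2 x) (WithLp.toLp 2 x)
  simp only at this
  rw [this]
  refine g.pos _ _ fun h => hx ?_
  simpa using mfderiv_symm_injective he hq h

lemma gLow_posDef {e : Chart n M} (he : e ∈ IsManifold.maximalAtlas (𝓡 n) ∞ M)
    {q : EuclideanSpace ℝ (Fin n)} (hq : q ∈ e.target) : (gLow g e q).PosDef := by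
  refine Matrix.PosDef.of_dotProduct_mulVec_pos ?_ fun x hx => ?_
  · rw [Matrix.IsHermitian, Matrix.conjTranspose_eq_transpose_of_trivial, gLow_transpose]
  · simpa using gLow_pos g he hq hx

/-- The transformation law of the metric under a change of charts. -/
lemma gLow_eq {e e' : Chart n M} (he : e ∈ IsManifold.maximalAtlas (𝓡 n) ∞ M)
    (he' : e' ∈ IsManifold.maximalAtlas (𝓡 n) ∞ M) {q : EuclideanSpace ℝ (Fin n)}
    (hq : q ∈ e.target) (hq' : e.symm q ∈ e'.source) :
    gLow g e q = (jac e e' q)ᵀ * gLow g e' (e' (e.symm q)) * jac e e' q := by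
  have aux : ∀ (x x' : M), x = x' → ∀ u v : EuclideanSpace ℝ (Fin n),
      g.inner x u v = g.inner x' u v := by
    rintro x _ rfl u v; rfl
  have hx : e.symm q = e'.symm (e' (e.symm q)) := (e'.left_inv hq').symm
  ext i j
  have h1 : gLow g e q i j = g.inner (e'.symm (e' (e.symm q)))
      (mfderiv (𝓡 n) (𝓡 n) e'.symm (e' (e.symm q))
        (fderiv ℝ (fun y => e' (e.symm y)) q (stdVec i) : EuclideanSpace ℝ (Fin n)))
      (mfderiv (𝓡 n) (𝓡 n) e'.symm (e' (e.symm q))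
        (fderiv ℝ (fun y => e' (e.symm y)) q (stdVec j) : EuclideanSpace ℝ (Fin n))) := by
    refine Eq.trans ?_ (aux _ _ hx _ _)
    exact congrArg₂ (fun u v : EuclideanSpace ℝ (Fin n) => g.inner (e.symm q) u v)
      (mfderiv_symm_eq he he' hq hq' _) (mfderiv_symm_eq he he' hq hq' _)
  rw [h1, ← dotProduct_gLow]
  have h2 : ∀ i, (fderiv ℝ (fun y => e' (e.symm y)) q (stdVec i)).ofLp = (jac e e' q).col i :=
    fun i => funext fun a => (jac_eq_fderiv he he' hq hq' a i).symm
  rw [h2, h2]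
  simp only [dotProduct, Matrix.mulVec, Matrix.mul_apply, Matrix.transpose_apply, Matrix.col_apply,
    Finset.mul_sum, Finset.sum_mul]
  rw [Finset.sum_comm]
  exact Finset.sum_congr rfl fun i _ => Finset.sum_congr rfl fun j _ => by ring

lemma contDiffOn_gLow {e : Chart n M} (he : e ∈ IsManifold.maximalAtlas (𝓡 n) ∞ M) (i j : Fin n) :
    ContDiffOn ℝ ∞ (fun q => gLow g e q i j) e.target := by
  have hsym := contMDiffOn_symm_of_mem_maximalAtlas he
  have hT := hsym.contMDiffOn_tangentMapWithin (m := ∞) (by simp) e.open_target.uniqueMDiffOn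
  have hvec : ∀ i : Fin n, ContMDiffOn (𝓡 n) (𝓡 n).tangent ∞
      (fun q => (⟨e.symm q, coordVec e q i⟩ : TangentBundle (𝓡 n) M)) e.target := by
    intro i
    have hc : ContMDiffOn (𝓡 n) (𝓡 n).tangent ∞
        (fun q => (⟨q, stdVec i⟩ : TangentBundle (𝓡 n) (EuclideanSpace ℝ (Fin n)))) e.target := by
      have := contMDiffOn_vectorSpace_iff_contDiffOn (𝕜 := ℝ) (n := ∞) (s := e.target)
        (V := fun q : EuclideanSpace ℝ (Fin n) => (stdVec i : EuclideanSpace ℝ (Fin n)))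
      exact this.2 contDiffOn_const
    refine (hT.comp hc fun q hq => hq).congr fun q hq => ?_
    simp only [Function.comp_apply, tangentMapWithin, coordVec]
    rw [mfderivWithin_of_isOpen e.open_target hq]
  have hg := g.contMDiff.comp_contMDiffOn hsym
  have := ContMDiffOn.clm_bundle_apply₂ (F₁ := EuclideanSpace ℝ (Fin n))
    (F₂ := EuclideanSpace ℝ (Fin n)) (F₃ := ℝ) (E₁ := fun x : M => TangentSpace (𝓡 n) x)
    (E₂ := fun x : M => TangentSpace (𝓡 n) x) (E₃ := Bundle.Trivial M ℝ)
    (ψ := fun q => g.inner (e.symm q)) hg (hvec i) (hvec j)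
  rw [← contMDiffOn_iff_contDiffOn]
  intro q hq
  have h2 := this q hq
  rw [Bundle.contMDiffWithinAt_totalSpace] at h2
  exact h2.2

end Manifold

/-! ### Levi-Civita connection and curvature in coordinates -/

section Matrices

variable {n : ℕ}

lemma fderiv_apply_eq_sum (f : EuclideanSpace ℝ (Fin n) → ℝ) (q v : EuclideanSpace ℝ (Fin n)) :
    fderiv ℝ f q v = ∑ i, v i * pderiv i f q := by
  conv_lhs => rw [← sum_smul_stdVec v, map_sum]
  simp [pderiv]

/-- The entrywise partial derivative of a matrix valued function. -/
def mderiv (i : Fin n) (B : EuclideanSpace ℝ (Fin n) → Matrix (Fin n) (Fin n) ℝ)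
    (q : EuclideanSpace ℝ (Fin n)) : Matrix (Fin n) (Fin n) ℝ :=
  Matrix.of fun a b => pderiv i (fun y => B y a b) q

lemma mderiv_mul (i : Fin n) {B C : EuclideanSpace ℝ (Fin n) → Matrix (Fin n) (Fin n) ℝ}
    {q : EuclideanSpace ℝ (Fin n)} (hB : ∀ a b, DifferentiableAt ℝ (fun y => B y a b) q)
    (hC : ∀ a b, DifferentiableAt ℝ (fun y => C y a b) q) :
    mderiv i (fun y => B y * C y) q = mderiv i B q * C q + B q * mderiv i C q := by
  ext a b
  have h : HasFDerivAt (fun y => (B y * C y) a b)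
      (∑ m, (B q a m • fderiv ℝ (fun y => C y m b) q + C q m b • fderiv ℝ (fun y => B y a m) q))
      q := by
    simp only [Matrix.mul_apply]
    exact HasFDerivAt.fun_sum fun m _ => (hB a m).hasFDerivAt.mul (hC m b).hasFDerivAt
  refine (congrArg (fun L => L (stdVec i)) h.fderiv).trans ?_
  simp only [mderiv, pderiv, Matrix.of_apply, Matrix.add_apply, Matrix.mul_apply,
    sum_apply, _root_.add_apply, smul_apply, smul_eq_mul, ← Finset.sum_add_distrib]
  exact Finset.sum_congr rfl fun m _ => by ring

lemma mderiv_add (i : Fin n) {B C : EuclideanSpace ℝ (Fin n) → Matrix (Fin n) (Fin n) ℝ}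
    {q : EuclideanSpace ℝ (Fin n)} (hB : ∀ a b, DifferentiableAt ℝ (fun y => B y a b) q)
    (hC : ∀ a b, DifferentiableAt ℝ (fun y => C y a b) q) :
    mderiv i (fun y => B y + C y) q = mderiv i B q + mderiv i C q := by
  ext a b
  have h := ((hB a b).hasFDerivAt.add (hC a b).hasFDerivAt).fderiv
  exact congrArg (fun L => L (stdVec i)) h

lemma mderiv_transpose (i : Fin n) (B : EuclideanSpace ℝ (Fin n) → Matrix (Fin n) (Fin n) ℝ)
    (q : EuclideanSpace ℝ (Fin n)) : mderiv i (fun y => (B y)ᵀ) q = (mderiv i B q)ᵀ := rfl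

lemma mderiv_congr (i : Fin n) {B C : EuclideanSpace ℝ (Fin n) → Matrix (Fin n) (Fin n) ℝ}
    {q : EuclideanSpace ℝ (Fin n)} (h : B =ᶠ[nhds q] C) : mderiv i B q = mderiv i C q := by
  ext a b
  have : (fun y => B y a b) =ᶠ[nhds q] fun y => C y a b := h.mono fun y hy => by simp only [hy]
  simp only [mderiv, pderiv, Matrix.of_apply, this.fderiv_eq]

lemma contDiffAt_pderiv {f : EuclideanSpace ℝ (Fin n) → ℝ} {q : EuclideanSpace ℝ (Fin n)}
    (hf : ContDiffAt ℝ ∞ f q) (i : Fin n) : ContDiffAt ℝ ∞ (pderiv i f) q :=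
  (hf.fderiv_right (m := ∞) (by simp)).clm_apply contDiffAt_const

lemma pderiv_comm {f : EuclideanSpace ℝ (Fin n) → ℝ} {q : EuclideanSpace ℝ (Fin n)}
    (hf : ContDiffAt ℝ ∞ f q) (i j : Fin n) :
    pderiv i (pderiv j f) q = pderiv j (pderiv i f) q := by
  have hd : DifferentiableAt ℝ (fderiv ℝ f) q :=
    (hf.fderiv_right (m := ∞) (by simp)).differentiableAt (by simp)
  have h : ∀ i j, pderiv i (pderiv j f) q = fderiv ℝ (fderiv ℝ f) q (stdVec i) (stdVec j) := by
    intro i j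
    have := (hd.hasFDerivAt.clm_apply (hasFDerivAt_const (stdVec j) q)).fderiv
    refine (congrArg (fun L => L (stdVec i)) this).trans ?_
    simp
  rw [h, h]
  exact (hf.isSymmSndFDerivAt (by rw [minSmoothness_of_isRCLikeNormedField]; exact WithTop.coe_le_coe.2 (le_top : (2 : ℕ∞) ≤ ⊤))).eq _ _

/-- An algebraic curvature tensor is determined by its sectional curvatures. -/
lemma curvatureTensor_eq_zero {W : Fin n → Fin n → Fin n → Fin n → ℝ}
    (h12 : ∀ l k i j, W l k i j = -W k l i j) (h34 : ∀ l k i j, W l k i j = -W l k j i)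
    (hB : ∀ l k i j, W l k i j + W l i j k + W l j k i = 0)
    (hs : ∀ x y : Fin n → ℝ, ∑ l, ∑ k, ∑ i, ∑ j, W l k i j * x l * y k * x i * y j = 0)
    (l k i j : Fin n) : W l k i j = 0 := by
  have hpair : ∀ l k i j, W l k i j = W i j l k := by
    intro l k i j
    linarith [hB l k i j, hB k l i j, hB i l k j, hB j l k i, h12 l k i j, h12 k i j l, h12 k j l i,
      h12 i l k j, h12 i k j l, h12 i j l k, h12 j l k i, h12 j k i l, h12 j i l k, h34 l k i j,
      h34 l i j k, h34 l j k i, h34 k l i j, h34 k i j l, h34 k j l i, h34 i l k j, h34 i k j l,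
      h34 i j l k, h34 j l k i, h34 j k i l, h34 j i l k, h12 l i j k, h12 l j k i]
  -- polarization in the second and fourth argument
  have h1 : ∀ (x : Fin n → ℝ) (k j : Fin n),
      ∑ l, ∑ i, W l k i j * x l * x i + ∑ l, ∑ i, W l j i k * x l * x i = 0 := by
    intro x k j
    have e1 := hs x (Pi.single k 1 + Pi.single j 1)
    have e2 := hs x (Pi.single k 1)
    have e3 := hs x (Pi.single j 1)
    simp only [Pi.add_apply, mul_add, add_mul, Finset.sum_add_distrib, Pi.single_apply, mul_ite,
      mul_one, mul_zero, ite_mul, zero_mul, Finset.sum_ite_irrel, Finset.sum_const_zero,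
      Finset.sum_ite_eq', Finset.mem_univ, if_true] at e1 e2 e3
    linarith
  have h2 : ∀ (x : Fin n → ℝ) (k j : Fin n), ∑ l, ∑ i, W l k i j * x l * x i = 0 := by
    intro x k j
    have : ∑ l, ∑ i, W l j i k * x l * x i = ∑ l, ∑ i, W l k i j * x l * x i := by
      rw [Finset.sum_comm]
      exact Finset.sum_congr rfl fun l _ => Finset.sum_congr rfl fun i _ => by
        rw [hpair]; ring
    linarith [h1 x k j]
  have h3 : ∀ l k i j, W l k i j + W i k l j = 0 := by
    intro l k i j
    have e1 := h2 (Pi.single l 1 + Pi.single i 1) k j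
    have e2 := h2 (Pi.single l 1) k j
    have e3 := h2 (Pi.single i 1) k j
    simp only [Pi.add_apply, mul_add, Finset.sum_add_distrib, Pi.single_apply, mul_ite,
      mul_one, mul_zero, Finset.sum_ite_eq', Finset.mem_univ, if_true] at e1 e2 e3
    linarith
  linarith [hB l k i j, h3 l k i j, h3 l k j i, h12 i k l j, h34 k i l j, h12 l i j k, h34 l k i j,
    h34 l j k i, h3 l i j k, h3 j i l k, h12 j k l i, h34 k j l i, h12 k j i l, h3 l j k i,
    h34 i l k j, h12 l j k i, h12 k i l j, h34 l i j k, h3 l i k j, h12 k i l j]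

end Matrices

section Metric

variable {n : ℕ} {M : Type*} [TopologicalSpace M] [ChartedSpace (EuclideanSpace ℝ (Fin n)) M]
  [IsManifold (𝓡 n) ∞ M] (g : Metric n M)

section

variable {e : Chart n M} (he : e ∈ IsManifold.maximalAtlas (𝓡 n) ∞ M)
  {q : EuclideanSpace ℝ (Fin n)} (hq : q ∈ e.target)

include he hq

lemma isUnit_det_gLow : IsUnit (gLow g e q).det :=
  (gLow_posDef g he hq).det_pos.ne'.isUnit

lemma gLow_mul_gUp : gLow g e q * gUp g e q = 1 :=
  Matrix.mul_nonsing_inv _ (isUnit_det_gLow g he hq)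

lemma gUp_mul_gLow : gUp g e q * gLow g e q = 1 :=
  Matrix.nonsing_inv_mul _ (isUnit_det_gLow g he hq)

lemma contDiffAt_gLow (i j : Fin n) : ContDiffAt ℝ ∞ (fun y => gLow g e y i j) q :=
  (contDiffOn_gLow g he i j).contDiffAt (e.open_target.mem_nhds hq)

lemma contDiffAt_gUp (i j : Fin n) : ContDiffAt ℝ ∞ (fun y => gUp g e y i j) q := by
  have hdet : ∀ B : EuclideanSpace ℝ (Fin n) → Matrix (Fin n) (Fin n) ℝ,
      (∀ a b, ContDiffAt ℝ ∞ (fun y => B y a b) q) → ContDiffAt ℝ ∞ (fun y => (B y).det) q := by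
    intro B hB
    simp only [Matrix.det_apply]
    exact ContDiffAt.sum fun σ _ => (contDiffAt_prod fun a _ => hB _ _).const_smul _
  simp only [gUp, Matrix.inv_def, Matrix.smul_apply, Ring.inverse_eq_inv', smul_eq_mul,
    Matrix.adjugate_apply]
  refine ((hdet _ (contDiffAt_gLow g he hq)).inv (isUnit_det_gLow g he hq).ne_zero).mul
    (hdet _ fun a b => ?_)
  by_cases h : a = j
  · subst h
    simpa using contDiffAt_const
  · simpa [h] using contDiffAt_gLow g he hq a b

lemma contDiffAt_christoffel (k i j : Fin n) : ContDiffAt ℝ ∞ (christoffel g e k i j) q := by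
  unfold christoffel
  have h := fun i j => contDiffAt_gLow g he hq i j
  exact contDiffAt_const.mul (ContDiffAt.sum fun l _ => (contDiffAt_gUp g he hq k l).mul
    (((contDiffAt_pderiv (h j l) i).add (contDiffAt_pderiv (h i l) j)).sub
      (contDiffAt_pderiv (h i j) l)))

end

lemma gUp_transpose (e : Chart n M) (q : EuclideanSpace ℝ (Fin n)) :
    (gUp g e q)ᵀ = gUp g e q := by
  rw [gUp, Matrix.transpose_nonsing_inv, gLow_transpose]

lemma gUp_symm (e : Chart n M) (q : EuclideanSpace ℝ (Fin n)) (i j : Fin n) :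
    gUp g e q i j = gUp g e q j i :=
  congrFun (congrFun (gUp_transpose g e q) j) i

lemma gLow_fun_symm (e : Chart n M) (i j : Fin n) :
    (fun y => gLow g e y i j) = fun y => gLow g e y j i :=
  funext fun y => gLow_symm g e y i j

lemma christoffel_symm (e : Chart n M) (k i j : Fin n) :
    christoffel g e k i j = christoffel g e k j i := by
  funext q
  simp only [christoffel, gLow_fun_symm g e j i]
  congr 1
  exact Finset.sum_congr rfl fun l _ => by ring

/-- The matrix `(Γᵢ)^k_j = Γ^k_{ij}` of the connection in the direction `∂ᵢ`. -/
def connMatrix (e : Chart n M) (i : Fin n) (q : EuclideanSpace ℝ (Fin n)) :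
    Matrix (Fin n) (Fin n) ℝ :=
  Matrix.of fun k j => christoffel g e k i j q

/-- The matrix of the curvature operator `R(∂ᵢ, ∂ⱼ)`. -/
lemma curvature_eq (e : Chart n M) (q : EuclideanSpace ℝ (Fin n)) (i j : Fin n) :
    (Matrix.of fun l k => curvature g e l k i j q) =
      mderiv i (connMatrix g e j) q - mderiv j (connMatrix g e i) q
        + (connMatrix g e i q * connMatrix g e j q - connMatrix g e j q * connMatrix g e i q) := by
  ext l k
  simp [curvature, mderiv, connMatrix, Matrix.mul_apply]

section

variable {e : Chart n M} (he : e ∈ IsManifold.maximalAtlas (𝓡 n) ∞ M)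
  {q : EuclideanSpace ℝ (Fin n)} (hq : q ∈ e.target)

include he hq

/-- The Christoffel symbols of the first kind. -/
lemma sum_gLow_mul_christoffel (m i j : Fin n) :
    ∑ k, gLow g e q m k * christoffel g e k i j q =
      (1 / 2) * (pderiv i (fun y => gLow g e y j m) q + pderiv j (fun y => gLow g e y i m) q
        - pderiv m (fun y => gLow g e y i j) q) := by
  set f : Fin n → ℝ := fun l => pderiv i (fun y => gLow g e y j l) q
    + pderiv j (fun y => gLow g e y i l) q - pderiv l (fun y => gLow g e y i j) q with hf
  have h : ∀ k, christoffel g e k i j q = (1 / 2) * (gUp g e q *ᵥ f) k := fun k => rfl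
  calc ∑ k, gLow g e q m k * christoffel g e k i j q
      = (1 / 2) * (gLow g e q *ᵥ (gUp g e q *ᵥ f)) m := by
        simp only [h, Matrix.mulVec, dotProduct, Finset.mul_sum]
        exact Finset.sum_congr rfl fun k _ => Finset.sum_congr rfl fun l _ => by ring
    _ = (1 / 2) * f m := by
        rw [Matrix.mulVec_mulVec, gLow_mul_gUp g he hq, Matrix.one_mulVec]

/-- The metric is parallel. -/
lemma mderiv_gLow (j : Fin n) :
    mderiv j (gLow g e) q = gLow g e q * connMatrix g e j q + (connMatrix g e j q)ᵀ * gLow g e q := by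
  ext k l
  have h1 := sum_gLow_mul_christoffel g he hq k j l
  have h2 := sum_gLow_mul_christoffel g he hq l j k
  rw [gLow_fun_symm g e l k] at h1
  rw [gLow_fun_symm g e j k, gLow_fun_symm g e j l] at h2
  rw [gLow_fun_symm g e j k, gLow_fun_symm g e j l] at h1
  simp only [mderiv, connMatrix, Matrix.of_apply, Matrix.add_apply, Matrix.mul_apply,
    Matrix.transpose_apply, h1]
  simp only [mul_comm (christoffel _ _ _ _ _ _), gLow_symm g e q _ l, h2]
  ring

/-- The inverse metric is parallel. -/
lemma mderiv_gUp (j : Fin n) :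
    mderiv j (gUp g e) q =
      -(connMatrix g e j q * gUp g e q + gUp g e q * (connMatrix g e j q)ᵀ) := by
  have h1 : mderiv j (fun y => gUp g e y * gLow g e y) q = 0 := by
    have : (fun y => gUp g e y * gLow g e y) =ᶠ[nhds q] fun _ => 1 := by
      filter_upwards [e.open_target.mem_nhds hq] with y hy
      exact gUp_mul_gLow g he hy
    rw [mderiv_congr j this]
    ext a b
    simp [mderiv, pderiv]
  rw [mderiv_mul j (fun a b => (contDiffAt_gUp g he hq a b).differentiableAt (by simp))
    (fun a b => (contDiffAt_gLow g he hq a b).differentiableAt (by simp)),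
    mderiv_gLow g he hq] at h1
  have h2 : mderiv j (gUp g e) q * (gLow g e q * gUp g e q) =
      -((gUp g e q * gLow g e q) * connMatrix g e j q * gUp g e q +
        gUp g e q * (connMatrix g e j q)ᵀ * (gLow g e q * gUp g e q)) := by
    have := congrArg (fun B => B * gUp g e q) (eq_neg_of_add_eq_zero_left h1)
    rw [← mul_assoc, this]
    noncomm_ring
  rwa [gLow_mul_gUp g he hq, gUp_mul_gLow g he hq, mul_one, one_mul, mul_one] at h2

/-- The Levi-Civita connection is the only torsion free connection for which the metric is
parallel. -/
lemma christoffel_unique {C : Fin n → Fin n → Fin n → ℝ} (hsymm : ∀ k i j, C k i j = C k j i)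
    (hC : ∀ j k l, pderiv j (fun y => gLow g e y k l) q =
      ∑ m, (gLow g e q k m * C m j l + gLow g e q l m * C m j k)) (k i j : Fin n) :
    C k i j = christoffel g e k i j q := by
  have h : ∀ m, ∑ k, gLow g e q m k * C k i j = ∑ k, gLow g e q m k * christoffel g e k i j q := by
    intro m
    rw [sum_gLow_mul_christoffel g he hq, hC, hC, hC]
    simp only [Finset.sum_add_distrib, hsymm _ m _, hsymm _ j i]
    ring
  have h2 : gLow g e q *ᵥ (fun k => C k i j) = gLow g e q *ᵥ fun k => christoffel g e k i j q :=
    funext h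
  have h3 := congrArg (fun v => gUp g e q *ᵥ v) h2
  simp only [Matrix.mulVec_mulVec, gUp_mul_gLow g he hq, Matrix.one_mulVec] at h3
  exact congrFun h3 k

/-- The curvature operators are skew-adjoint: this is the symmetry of the second derivatives of
the metric. -/
lemma gLow_mul_curvature_add (i j : Fin n) :
    gLow g e q * (Matrix.of fun l k => curvature g e l k i j q)
      + (Matrix.of fun l k => curvature g e l k i j q)ᵀ * gLow g e q = 0 := by
  have dg : ∀ a b, DifferentiableAt ℝ (fun y => gLow g e y a b) q := fun a b =>
    (contDiffAt_gLow g he hq a b).differentiableAt (by simp)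
  have dΓ : ∀ j a b, DifferentiableAt ℝ (fun y => connMatrix g e j y a b) q := fun j a b =>
    (contDiffAt_christoffel g he hq a j b).differentiableAt (by simp)
  have dmul : ∀ B C : EuclideanSpace ℝ (Fin n) → Matrix (Fin n) (Fin n) ℝ,
      (∀ a b, DifferentiableAt ℝ (fun y => B y a b) q) →
      (∀ a b, DifferentiableAt ℝ (fun y => C y a b) q) →
      ∀ a b, DifferentiableAt ℝ (fun y => (B y * C y) a b) q := by
    intro B C hB hC a b
    simp only [Matrix.mul_apply]
    exact DifferentiableAt.fun_sum fun m _ => (hB a m).mul (hC m b)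
  have key : ∀ i j, mderiv i (mderiv j (gLow g e)) q =
      (gLow g e q * connMatrix g e i q + (connMatrix g e i q)ᵀ * gLow g e q) * connMatrix g e j q
        + gLow g e q * mderiv i (connMatrix g e j) q
        + ((mderiv i (connMatrix g e j) q)ᵀ * gLow g e q + (connMatrix g e j q)ᵀ *
          (gLow g e q * connMatrix g e i q + (connMatrix g e i q)ᵀ * gLow g e q)) := by
    intro i j
    have : mderiv j (gLow g e) =ᶠ[nhds q] fun y => gLow g e y * connMatrix g e j y
        + (connMatrix g e j y)ᵀ * gLow g e y := by
      filter_upwards [e.open_target.mem_nhds hq] with y hy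
      exact mderiv_gLow g he hy j
    have dΓt : ∀ a b, DifferentiableAt ℝ (fun y => (connMatrix g e j y)ᵀ a b) q :=
      fun a b => dΓ j b a
    rw [mderiv_congr i this, mderiv_add i (dmul _ _ dg (dΓ j)) (dmul _ _ dΓt dg),
      mderiv_mul i dg (dΓ j), mderiv_mul i dΓt dg, mderiv_transpose, mderiv_gLow g he hq]
  have hcomm : mderiv i (mderiv j (gLow g e)) q = mderiv j (mderiv i (gLow g e)) q := by
    ext a b
    exact pderiv_comm (contDiffAt_gLow g he hq a b) i j
  rw [key, key, ← sub_eq_zero] at hcomm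
  rw [curvature_eq g e q, ← hcomm]
  simp only [Matrix.transpose_add, Matrix.transpose_sub, Matrix.transpose_mul]
  noncomm_ring

/-- In constant curvature, `R(∂ᵢ, ∂ⱼ)∂ₖ = c (g_{kj} ∂ᵢ - g_{ki} ∂ⱼ)`. -/
lemma curvature_of_constant {c : ℝ} (hc : HasConstantSectionalCurvature g c) (l k i j : Fin n) :
    curvature g e l k i j q = c * ((1 : Matrix (Fin n) (Fin n) ℝ) l i * gLow g e q k j
      - (1 : Matrix (Fin n) (Fin n) ℝ) l j * gLow g e q k i) := by
  have hskew : ∀ l k i j, ∑ m, gLow g e q l m * curvature g e m k i j q =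
      -∑ m, gLow g e q k m * curvature g e m l i j q := by
    intro l k i j
    have h := congrFun (congrFun (gLow_mul_curvature_add g he hq i j) l) k
    simp only [Matrix.add_apply, Matrix.mul_apply, Matrix.transpose_apply, Matrix.of_apply,
      Matrix.zero_apply, mul_comm (curvature _ _ _ _ _ _ _), gLow_symm g e q _ k] at h
    linarith
  have h34 : ∀ m k i j, curvature g e m k i j q = -curvature g e m k j i q := by
    intro m k i j
    simp only [curvature, Finset.sum_sub_distrib]
    ring
  have hB : ∀ m k i j, curvature g e m k i j q + curvature g e m i j k q
      + curvature g e m j k i q = 0 := by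
    intro m k i j
    simp only [curvature, Finset.sum_sub_distrib, christoffel_symm g e m j i,
      christoffel_symm g e _ k j, christoffel_symm g e _ k i, christoffel_symm g e _ j i]
    ring
  have h0 : ∀ l k i j, (∑ m, gLow g e q l m * curvature g e m k i j q)
      - c * (gLow g e q l i * gLow g e q k j - gLow g e q l j * gLow g e q k i) = 0 := by
    refine curvatureTensor_eq_zero (fun l k i j => ?_) (fun l k i j => ?_) (fun l k i j => ?_)
      fun x y => ?_
    · rw [hskew]; ring
    · simp only [h34 _ _ i j, mul_neg, Finset.sum_neg_distrib]; ring
    · have : ∑ m, gLow g e q l m * (curvature g e m k i j q + curvature g e m i j k q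
          + curvature g e m j k i q) = 0 := by simp only [hB, mul_zero, Finset.sum_const_zero]
      simp only [mul_add, Finset.sum_add_distrib] at this
      rw [gLow_symm g e q j i, gLow_symm g e q k i, gLow_symm g e q k j]
      linear_combination this
    · have h := hc e he q hq x y
      rw [← sub_eq_zero] at h
      rw [← h]
      simp only [sub_mul, Finset.sum_sub_distrib]
      congr 1
      · have hcomm : ∀ f : Fin n → Fin n → Fin n → Fin n → ℝ,
            ∑ k, ∑ i, ∑ j, ∑ m, f k i j m = ∑ m, ∑ i, ∑ j, ∑ k, f k i j m := by
          intro f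
          calc _ = ∑ k, ∑ m, ∑ i, ∑ j, f k i j m := Finset.sum_congr rfl fun k _ =>
                (Finset.sum_congr rfl fun i _ => Finset.sum_comm).trans Finset.sum_comm
            _ = ∑ m, ∑ k, ∑ i, ∑ j, f k i j m := Finset.sum_comm
            _ = _ := Finset.sum_congr rfl fun m _ => Finset.sum_comm.trans
                (Finset.sum_congr rfl fun i _ => Finset.sum_comm)
        simp only [innerCoord, curvatureVec, Finset.mul_sum, Finset.sum_mul]
        refine Eq.trans (Finset.sum_congr rfl fun l _ => ?_) Finset.sum_comm
        rw [hcomm]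
        refine Finset.sum_congr rfl fun m _ => Finset.sum_congr rfl fun i _ =>
          Finset.sum_congr rfl fun j _ => Finset.sum_congr rfl fun k _ => ?_
        rw [gLow_symm g e q l m]
        ring
      · have hin : ∀ x y, innerCoord g e q x y = ∑ l, x l * ∑ i, gLow g e q l i * y i := by
          intro x y
          simp only [innerCoord, Finset.mul_sum]
          exact Finset.sum_congr rfl fun l _ => Finset.sum_congr rfl fun m _ => by ring
        have hxy : innerCoord g e q x y = innerCoord g e q y x := by
          simp only [innerCoord]
          rw [Finset.sum_comm]
          exact Finset.sum_congr rfl fun l _ => Finset.sum_congr rfl fun m _ => by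
            rw [gLow_symm]; ring
        have hmul : ∀ f : Fin n → Fin n → ℝ, c * ∑ l, ∑ k, f l k = ∑ l, ∑ k, c * f l k := by
          intro f
          simp only [Finset.mul_sum]
        have hsq : innerCoord g e q x y ^ 2 = innerCoord g e q x y * innerCoord g e q y x := by
          rw [sq, ← hxy]
        rw [hsq, hin, hin, hin, hin, mul_sub, Finset.sum_mul_sum, Finset.sum_mul_sum, hmul, hmul]
        simp only [← Finset.sum_sub_distrib]
        refine Finset.sum_congr rfl fun l _ => Finset.sum_congr rfl fun k _ => ?_
        have e1 : ∀ a b : Fin n → ℝ, ∑ i, ∑ j, c * (gLow g e q l i * a i) * (gLow g e q k j * b j)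
            = c * (∑ i, gLow g e q l i * a i) * ∑ j, gLow g e q k j * b j := by
          intro a b
          rw [mul_assoc, Finset.sum_mul_sum, Finset.mul_sum]
          exact Finset.sum_congr rfl fun i _ => by
            rw [Finset.mul_sum]
            exact Finset.sum_congr rfl fun j _ => by ring
        have e2 : ∑ i, ∑ j, c * (gLow g e q l j * y j) * (gLow g e q k i * x i)
            = c * (∑ i, gLow g e q l i * y i) * ∑ j, gLow g e q k j * x j := by
          rw [Finset.sum_comm, e1]
        have e3 : c * ((x l * ∑ i, gLow g e q l i * x i) * (y k * ∑ i, gLow g e q k i * y i))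
            - c * ((x l * ∑ i, gLow g e q l i * y i) * (y k * ∑ i, gLow g e q k i * x i))
            = x l * y k * (c * (∑ i, gLow g e q l i * x i) * ∑ j, gLow g e q k j * y j)
              - x l * y k * (c * (∑ i, gLow g e q l i * y i) * ∑ j, gLow g e q k j * x j) := by
          ring
        rw [e3, ← e1, ← e2]
        simp only [Finset.mul_sum, ← Finset.sum_sub_distrib]
        exact Finset.sum_congr rfl fun i _ => Finset.sum_congr rfl fun j _ => by ring
  have h1 : gLow g e q *ᵥ (fun m => curvature g e m k i j q) = gLow g e q *ᵥ fun m =>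
      c * ((1 : Matrix (Fin n) (Fin n) ℝ) m i * gLow g e q k j
        - (1 : Matrix (Fin n) (Fin n) ℝ) m j * gLow g e q k i) := by
    funext l
    rw [Matrix.mulVec, dotProduct, sub_eq_zero.1 (h0 l k i j)]
    simp [Matrix.mulVec, dotProduct, Matrix.one_apply, mul_sub, Finset.sum_sub_distrib]
    ring
  have h3 := congrArg (fun v => gUp g e q *ᵥ v) h1
  simp only [Matrix.mulVec_mulVec, gUp_mul_gLow g he hq, Matrix.one_mulVec] at h3
  exact congrFun h3 l

end

end Metric

/-! ### Smoothness and the derivative of the energy density -/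

section Metric

variable {n : ℕ} {M : Type*} [TopologicalSpace M] [ChartedSpace (EuclideanSpace ℝ (Fin n)) M]
  [IsManifold (𝓡 n) ∞ M] (g : Metric n M)

lemma energy_eq (e : Chart n M) (z : Phase n) :
    energy g e z = (1 / 2) * (z.2 ⬝ᵥ gUp g e z.1 *ᵥ z.2) := by
  simp only [energy, dotProduct, Matrix.mulVec, Finset.mul_sum]
  exact Finset.sum_congr rfl fun i _ => Finset.sum_congr rfl fun k _ => by ring

lemma gZero_eq (e : Chart n M) (z : Phase n) : gZero g e z = gUp g e z.1 *ᵥ z.2 := by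
  funext i
  simp only [gZero, dotProduct, Matrix.mulVec]
  exact Finset.sum_congr rfl fun h _ => by rw [gUp_symm, mul_comm]

lemma dotProduct_gZero (e : Chart n M) (z : Phase n) : z.2 ⬝ᵥ gZero g e z = 2 * energy g e z := by
  rw [energy_eq, gZero_eq]; ring

lemma christoffelZero_symm (e : Chart n M) (z : Phase n) (i j : Fin n) :
    christoffelZero g e z i j = christoffelZero g e z j i := by
  simp only [christoffelZero, christoffel_symm g e _ i j]

lemma covDp_apply (e : Chart n M) (z u : Phase n) (i : Fin n) :
    covDp g e z i u = u.2 i - ∑ j, christoffelZero g e z i j * u.1 j := by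
  simp [covDp, dp, dq]

lemma dq_apply (i : Fin n) (u : Phase n) : dq i u = u.1 i := rfl

lemma dp_apply (i : Fin n) (u : Phase n) : dp i u = u.2 i := rfl

variable {g} in
lemma phase_ext {e : Chart n M} {z u v : Phase n} (h1 : ∀ i, u.1 i = v.1 i)
    (h2 : ∀ i, covDp g e z i u = covDp g e z i v) : u = v := by
  have h : u.1 = v.1 := by ext i; exact h1 i
  refine Prod.ext h (funext fun i => ?_)
  have := h2 i
  rw [covDp_apply, covDp_apply, h] at this
  linarith

lemma contDiffAt_comp_fst {f : EuclideanSpace ℝ (Fin n) → ℝ} {z : Phase n}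
    (hf : ContDiffAt ℝ ∞ f z.1) : ContDiffAt ℝ ∞ (fun y : Phase n => f y.1) z :=
  ContDiffAt.comp z hf contDiffAt_fst

lemma contDiffAt_snd_apply (i : Fin n) (z : Phase n) :
    ContDiffAt ℝ ∞ (fun y : Phase n => y.2 i) z :=
  (dp (n := n) i).contDiff.contDiffAt

lemma fderiv_comp_fst {f : EuclideanSpace ℝ (Fin n) → ℝ} {z : Phase n}
    (hf : ContDiffAt ℝ ∞ f z.1) (u : Phase n) :
    fderiv ℝ (fun y : Phase n => f y.1) z u = ∑ j, u.1 j * pderiv j f z.1 := by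
  have h := (hf.differentiableAt (by simp)).hasFDerivAt.comp z (hasFDerivAt_fst (𝕜 := ℝ))
  rw [← fderiv_apply_eq_sum]
  exact congrArg (fun L => L u) h.fderiv

lemma fderiv_snd_apply (i : Fin n) (z u : Phase n) :
    fderiv ℝ (fun y : Phase n => y.2 i) z u = u.2 i :=
  congrArg (fun L => L u) (dp (n := n) i).fderiv

section

variable {e : Chart n M} (he : e ∈ IsManifold.maximalAtlas (𝓡 n) ∞ M)
  {z : Phase n} (hz : z.1 ∈ e.target)

include he hz

lemma contDiffAt_energy : ContDiffAt ℝ ∞ (energy g e) z := by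
  unfold energy
  exact contDiffAt_const.mul (ContDiffAt.sum fun i _ => ContDiffAt.sum fun k _ =>
    ((contDiffAt_comp_fst (contDiffAt_gUp g he hz i k)).mul (contDiffAt_snd_apply i z)).mul
      (contDiffAt_snd_apply k z))

lemma contDiffAt_gZero (i : Fin n) : ContDiffAt ℝ ∞ (fun y => gZero g e y i) z := by
  unfold gZero
  exact ContDiffAt.sum fun h _ => (contDiffAt_snd_apply h z).mul
    (contDiffAt_comp_fst (contDiffAt_gUp g he hz h i))

lemma contDiffAt_christoffelZero (i j : Fin n) :
    ContDiffAt ℝ ∞ (fun y => christoffelZero g e y i j) z := by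
  unfold christoffelZero
  exact ContDiffAt.sum fun k _ => (contDiffAt_snd_apply k z).mul
    (contDiffAt_comp_fst (contDiffAt_christoffel g he hz k i j))

lemma contDiffAt_covDp (i : Fin n) : ContDiffAt ℝ ∞ (fun y => covDp g e y i) z := by
  unfold covDp
  exact contDiffAt_const.sub (ContDiffAt.sum fun j _ =>
    (contDiffAt_christoffelZero g he hz i j).smul contDiffAt_const)

lemma contDiffAt_deltaQ (i : Fin n) : ContDiffAt ℝ ∞ (fun y => deltaQ g e y i) z := by
  unfold deltaQ
  exact contDiffAt_const.prodMk (contDiffAt_pi.2 fun h => contDiffAt_christoffelZero g he hz i h)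

/-- `dt = g^{0h} Dp_h`: the energy density is constant along horizontal vectors. -/
lemma fderiv_energy (u : Phase n) :
    fderiv ℝ (energy g e) z u = ∑ h, gZero g e z h * covDp g e z h u := by
  have hU := fun i k => (contDiffAt_comp_fst (contDiffAt_gUp g he hz i k)).differentiableAt (by simp)
  have hp := fun i => (contDiffAt_snd_apply i z).differentiableAt (by simp)
  have h1 : fderiv ℝ (energy g e) z u = (1 / 2) * ∑ i, ∑ k,
      ((∑ j, u.1 j * mderiv j (gUp g e) z.1 i k) * z.2 i * z.2 k
        + gUp g e z.1 i k * u.2 i * z.2 k + gUp g e z.1 i k * z.2 i * u.2 k) := by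
    have h : HasFDerivAt (energy g e) _ z := HasFDerivAt.const_mul
      (HasFDerivAt.fun_sum (u := Finset.univ) fun i _ => HasFDerivAt.fun_sum (u := Finset.univ)
        fun k _ => (((hU i k).hasFDerivAt.mul (hp i).hasFDerivAt).mul (hp k).hasFDerivAt)) (1 / 2)
    refine (congrArg (fun L => L u) h.fderiv).trans ?_
    simp only [smul_apply, sum_apply, _root_.add_apply, smul_eq_mul, fderiv_snd_apply,
      fderiv_comp_fst (contDiffAt_gUp g he hz _ _), Pi.mul_apply]
    congr 1
    refine Finset.sum_congr rfl fun i _ => Finset.sum_congr rfl fun k _ => ?_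
    simp only [mderiv, Matrix.of_apply]
    ring
  have h2 : ∀ j, ∑ i, ∑ k, mderiv j (gUp g e) z.1 i k * z.2 i * z.2 k =
      -2 * ∑ h, gZero g e z h * christoffelZero g e z h j := by
    intro j
    have e1 : ∑ i, ∑ k, mderiv j (gUp g e) z.1 i k * z.2 i * z.2 k =
        z.2 ⬝ᵥ mderiv j (gUp g e) z.1 *ᵥ z.2 := by
      simp only [dotProduct, Matrix.mulVec, Finset.mul_sum]
      exact Finset.sum_congr rfl fun i _ => Finset.sum_congr rfl fun k _ => by ring
    have e2 : (fun h => christoffelZero g e z h j) = z.2 ᵥ* connMatrix g e j z.1 := by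
      funext h
      rw [christoffelZero_symm]
      rfl
    have e3 : ∑ h, gZero g e z h * christoffelZero g e z h j =
        gZero g e z ⬝ᵥ fun h => christoffelZero g e z h j := rfl
    rw [e1, e3, e2, mderiv_gUp g he hz, gZero_eq, Matrix.neg_mulVec, Matrix.add_mulVec,
      dotProduct_neg, dotProduct_add, ← Matrix.mulVec_mulVec, ← Matrix.mulVec_mulVec,
      Matrix.dotProduct_mulVec, Matrix.mulVec_transpose, Matrix.dotProduct_mulVec (z.2) (gUp g e z.1),
      ← Matrix.mulVec_transpose (gUp g e z.1), gUp_transpose,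
      dotProduct_comm (z.2 ᵥ* connMatrix g e j z.1)]
    ring
  have h3 : ∀ (a : Fin n → ℝ), ∑ i, ∑ k, gUp g e z.1 i k * a i * z.2 k =
      ∑ i, gZero g e z i * a i := by
    intro a
    simp only [gZero_eq, Matrix.mulVec, dotProduct, Finset.sum_mul]
    exact Finset.sum_congr rfl fun i _ => Finset.sum_congr rfl fun k _ => by ring
  have h4 : ∑ i, ∑ k, gUp g e z.1 i k * z.2 i * u.2 k = ∑ i, gZero g e z i * u.2 i := by
    rw [← h3, Finset.sum_comm]
    exact Finset.sum_congr rfl fun i _ => Finset.sum_congr rfl fun k _ => by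
      rw [gUp_symm]; ring
  have h5 : ∑ i, ∑ k, (∑ j, u.1 j * mderiv j (gUp g e) z.1 i k) * z.2 i * z.2 k =
      ∑ j, u.1 j * ∑ i, ∑ k, mderiv j (gUp g e) z.1 i k * z.2 i * z.2 k := by
    simp only [Finset.mul_sum, Finset.sum_mul]
    refine (Finset.sum_congr rfl fun i _ => Finset.sum_comm).trans (Finset.sum_comm.trans ?_)
    exact Finset.sum_congr rfl fun i _ => Finset.sum_congr rfl fun k _ =>
      Finset.sum_congr rfl fun j _ => by ring
  have h6 : ∑ j, u.1 j * (-2 * ∑ h, gZero g e z h * christoffelZero g e z h j) =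
      -2 * ∑ h, gZero g e z h * ∑ j, christoffelZero g e z h j * u.1 j := by
    simp only [Finset.mul_sum]
    rw [Finset.sum_comm]
    exact Finset.sum_congr rfl fun i _ => Finset.sum_congr rfl fun k _ => by ring
  rw [h1]
  simp only [Finset.sum_add_distrib]
  simp only [h5, h2, h6, h3, h4, covDp_apply, mul_sub, Finset.sum_sub_distrib]
  ring

lemma gUp_pos {x : Fin n → ℝ} (hx : x ≠ 0) : 0 < x ⬝ᵥ gUp g e z.1 *ᵥ x := by
  have h := (gLow_posDef g he hz).inv.dotProduct_mulVec_pos hx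
  simpa [gUp] using h

end

section

variable {e : Chart n M} (he : e ∈ IsManifold.maximalAtlas (𝓡 n) ∞ M)
  {z : Phase n} (hz : z ∈ inducedTarget e)

include he hz

lemma energy_pos : 0 < energy g e z := by
  obtain ⟨h1, h2⟩ := (mem_inducedTarget_iff he z).1 hz
  rw [energy_eq]
  have := gUp_pos g he h1 h2
  positivity

lemma contDiffAt_comp_energy {f : ℝ → ℝ} (hf : ContDiffOn ℝ ∞ f (Set.Ioi 0)) :
    ContDiffAt ℝ ∞ (fun y => f (energy g e y)) z :=
  ContDiffAt.comp z (hf.contDiffAt (Ioi_mem_nhds (energy_pos g he hz)))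
    (contDiffAt_energy g he hz.1)

end

end Metric

/-! ### The structures at a point -/

section Coefficients

/-- The coefficient `b₁` of `p ⊗ p` in `J^{(1)}`. -/
def coeffB1 (A c : ℝ) (lam : ℝ → ℝ) (t : ℝ) : ℝ :=
  (c - A ^ 2 * t * lam t * (lam t + t * deriv lam t)) / (A * t * (lam t + 2 * t * deriv lam t))

/-- The coefficient `b₂` of `p♯ ⊗ p♯` in `J_{(2)}`. -/
def coeffB2 (A c : ℝ) (lam : ℝ → ℝ) (t : ℝ) : ℝ :=
  -((c - A ^ 2 * t * lam t * (lam t + t * deriv lam t)) /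
    (A * t ^ 2 * lam t * (2 * c - A ^ 2 * t * lam t ^ 2)))

/-- The coefficient `d₁` of `p ⊗ p` in `G^{(1)}`. -/
def coeffD1 (A c : ℝ) (lam mu : ℝ → ℝ) (t : ℝ) : ℝ :=
  (lam t * (c - A ^ 2 * t * lam t * (lam t + t * deriv lam t))
    + mu t * t * (2 * c - A ^ 2 * t * lam t ^ 2)) / (A * t * (lam t + 2 * t * deriv lam t))

/-- The coefficient `d₂` of `p♯ ⊗ p♯` in `G_{(2)}`. -/
def coeffD2 (A c : ℝ) (lam mu : ℝ → ℝ) (t : ℝ) : ℝ :=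
  (-c + A ^ 2 * t * lam t * (lam t + t * deriv lam t)
    + mu t * A ^ 2 * t ^ 2 * (lam t + 2 * t * deriv lam t)) /
    (A * t ^ 2 * (2 * c - A ^ 2 * t * lam t ^ 2))

variable {A c : ℝ} {lam mu : ℝ → ℝ} {t : ℝ} (hA : 0 < A) (ht : 0 < t) (hl : 0 < lam t)
  (hquot : 0 < (2 * c - A ^ 2 * t * lam t ^ 2) / (lam t + 2 * t * deriv lam t))

section

include hquot

/-- The quotient would be `0` if its denominator vanished. -/
lemma denominator_ne_zero : lam t + 2 * t * deriv lam t ≠ 0 := by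
  intro h
  simp [h] at hquot

lemma numerator_ne_zero : 2 * c - A ^ 2 * t * lam t ^ 2 ≠ 0 := by
  intro h
  simp [h] at hquot

end

lemma numerator_relation : c - A ^ 2 * t * lam t * (lam t + t * deriv lam t) =
    ((2 * c - A ^ 2 * t * lam t ^ 2) - A ^ 2 * t * lam t * (lam t + 2 * t * deriv lam t)) / 2 := by
  ring

include hA ht hl hquot

lemma coeff_J1_J2 : A * t * lam t * coeffB2 A c lam t + coeffB1 A c lam t * (1 / (A * t * lam t))
    + 2 * t * coeffB1 A c lam t * coeffB2 A c lam t = 0 := by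
  have h1 := denominator_ne_zero hquot
  have h2 := numerator_ne_zero hquot
  unfold coeffB1 coeffB2
  rw [numerator_relation]
  generalize lam t + 2 * t * deriv lam t = L at h1 ⊢
  generalize 2 * c - A ^ 2 * t * lam t ^ 2 = K at h2 ⊢
  generalize lam t = l at hl ⊢
  field_simp
  ring

omit hl in
lemma coeff_G2_J1 : 1 / (A * t) * coeffB1 A c lam t + coeffD2 A c lam mu t * (A * t * lam t)
    + 2 * t * coeffD2 A c lam mu t * coeffB1 A c lam t = mu t := by
  have h1 := denominator_ne_zero hquot
  have h2 := numerator_ne_zero hquot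
  unfold coeffB1 coeffD2
  have h3 : -c + A ^ 2 * t * lam t * (lam t + t * deriv lam t) =
    -(c - A ^ 2 * t * lam t * (lam t + t * deriv lam t)) := by ring
  rw [h3, numerator_relation]
  generalize lam t + 2 * t * deriv lam t = L at h1 ⊢
  generalize 2 * c - A ^ 2 * t * lam t ^ 2 = K at h2 ⊢
  generalize lam t = l
  field_simp
  ring

omit hl in
lemma coeff_J1_C : A * t * lam t * mu t + coeffB1 A c lam t * lam t
    + 2 * t * coeffB1 A c lam t * mu t = coeffD1 A c lam mu t := by
  have h1 := denominator_ne_zero hquot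
  unfold coeffB1 coeffD1
  rw [numerator_relation]
  generalize lam t + 2 * t * deriv lam t = L at h1 ⊢
  generalize 2 * c - A ^ 2 * t * lam t ^ 2 = K
  generalize lam t = l
  field_simp
  ring

omit hl in
lemma coeff_J1_trace : A * t * lam t + 2 * t * coeffB1 A c lam t =
    (2 * c - A ^ 2 * t * lam t ^ 2) / (lam t + 2 * t * deriv lam t) / A := by
  have h1 := denominator_ne_zero hquot
  unfold coeffB1
  rw [numerator_relation]
  generalize lam t + 2 * t * deriv lam t = L at h1 ⊢
  generalize 2 * c - A ^ 2 * t * lam t ^ 2 = K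
  field_simp
  ring

omit hl in
lemma coeff_G1_pos (hmu : 0 < lam t + 2 * t * mu t) :
    0 < A * t * lam t ^ 2 + 2 * t * coeffD1 A c lam mu t := by
  have h : A * t * lam t ^ 2 + 2 * t * coeffD1 A c lam mu t =
      (A * t * lam t + 2 * t * coeffB1 A c lam t) * (lam t + 2 * t * mu t) := by
    rw [← coeff_J1_C hA ht hquot]; ring
  rw [h, coeff_J1_trace hA ht hquot]
  positivity

omit hl in
lemma coeff_G2_pos (hmu : 0 < lam t + 2 * t * mu t) :
    0 < 1 / (A * t) + 2 * t * coeffD2 A c lam mu t := by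
  have h : (1 / (A * t) + 2 * t * coeffD2 A c lam mu t) *
      (A * t * lam t + 2 * t * coeffB1 A c lam t) = lam t + 2 * t * mu t := by
    rw [← coeff_G2_J1 (mu := mu) hA ht hquot]
    field_simp
    ring
  have h2 : 0 < A * t * lam t + 2 * t * coeffB1 A c lam t := by
    rw [coeff_J1_trace hA ht hquot]
    positivity
  exact pos_of_mul_pos_left (h ▸ hmu) h2.le

end Coefficients

section Metric

/-- By the Cauchy-Schwarz inequality, `a B + b (Bv) ⊗ (Bv)` is positive definite if `a > 0` and
`a + b B(v, v) > 0`. -/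
lemma quadraticForm_pos {n : ℕ} {B : Matrix (Fin n) (Fin n) ℝ} (hB : ∀ x, x ≠ 0 → 0 < x ⬝ᵥ B *ᵥ x)
    (hsymm : Bᵀ = B) {v : Fin n → ℝ} {t a b : ℝ} (hv : v ⬝ᵥ B *ᵥ v = 2 * t) (ht : 0 < t)
    (ha : 0 < a) (hab : 0 < a + 2 * t * b) {x : Fin n → ℝ} (hx : x ≠ 0) :
    0 < a * (x ⬝ᵥ B *ᵥ x) + b * (v ⬝ᵥ B *ᵥ x) ^ 2 := by
  have hw := hB x hx
  have hs : x ⬝ᵥ B *ᵥ v = v ⬝ᵥ B *ᵥ x := by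
    rw [Matrix.dotProduct_mulVec, ← Matrix.mulVec_transpose, hsymm, dotProduct_comm]
  set w := x ⬝ᵥ B *ᵥ x
  set s := v ⬝ᵥ B *ᵥ x
  have hcs : s ^ 2 ≤ 2 * t * w := by
    have h0 : 0 ≤ ((2 * t) • x - s • v) ⬝ᵥ B *ᵥ ((2 * t) • x - s • v) := by
      by_cases h : (2 * t) • x - s • v = 0
      · simp [h]
      · exact (hB _ h).le
    simp only [Matrix.mulVec_sub, Matrix.mulVec_smul, sub_dotProduct, dotProduct_sub,
      smul_dotProduct, dotProduct_smul, smul_eq_mul, hv, hs] at h0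
    have h1 : 0 ≤ 2 * t * (2 * t * w - s ^ 2) := by
      linarith
    have := nonneg_of_mul_nonneg_right h1 (by positivity)
    linarith
  rcases le_or_gt 0 b with hb | hb
  · have := mul_nonneg hb (sq_nonneg s)
    have := mul_pos ha hw
    linarith
  · nlinarith [mul_pos hab hw]

variable {n : ℕ} {M : Type*} [TopologicalSpace M] [ChartedSpace (EuclideanSpace ℝ (Fin n)) M]
  [IsManifold (𝓡 n) ∞ M] (g : Metric n M)

/-- The bilinear form `a g + b p ⊗ p` on tangent vectors. -/
def lowMat (e : Chart n M) (z : Phase n) (a b : ℝ) : Matrix (Fin n) (Fin n) ℝ :=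
  a • gLow g e z.1 + b • Matrix.vecMulVec z.2 z.2

/-- The bilinear form `a g⁻¹ + b p♯ ⊗ p♯` on covectors. -/
def upMat (e : Chart n M) (z : Phase n) (a b : ℝ) : Matrix (Fin n) (Fin n) ℝ :=
  a • gUp g e z.1 + b • Matrix.vecMulVec (gZero g e z) (gZero g e z)

/-- The vertical components `Dpᵢ(u)`. -/
def vertPart (e : Chart n M) (z u : Phase n) : Fin n → ℝ := fun i => covDp g e z i u

lemma lowMat_apply (e : Chart n M) (z : Phase n) (a b : ℝ) (i j : Fin n) :
    lowMat g e z a b i j = a * gLow g e z.1 i j + b * z.2 i * z.2 j := by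
  simp [lowMat, Matrix.vecMulVec_apply, mul_assoc]

lemma upMat_apply (e : Chart n M) (z : Phase n) (a b : ℝ) (i j : Fin n) :
    upMat g e z a b i j = a * gUp g e z.1 i j + b * gZero g e z i * gZero g e z j := by
  simp [upMat, Matrix.vecMulVec_apply, mul_assoc]

lemma lowMat_transpose (e : Chart n M) (z : Phase n) (a b : ℝ) :
    (lowMat g e z a b)ᵀ = lowMat g e z a b := by
  simp [lowMat, gLow_transpose]

lemma upMat_transpose (e : Chart n M) (z : Phase n) (a b : ℝ) :
    (upMat g e z a b)ᵀ = upMat g e z a b := by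
  simp [upMat, gUp_transpose]

section

variable {e : Chart n M} (he : e ∈ IsManifold.maximalAtlas (𝓡 n) ∞ M)
  {z : Phase n} (hz : z.1 ∈ e.target)

lemma gUp_mul_vecMulVec (w : Fin n → ℝ) :
    gUp g e z.1 * Matrix.vecMulVec z.2 w = Matrix.vecMulVec (gZero g e z) w := by
  rw [Matrix.mul_vecMulVec, gZero_eq]

lemma vecMulVec_mul_gUp (w : Fin n → ℝ) :
    Matrix.vecMulVec w z.2 * gUp g e z.1 = Matrix.vecMulVec w (gZero g e z) := by
  rw [Matrix.vecMulVec_mul, ← Matrix.mulVec_transpose, gUp_transpose, gZero_eq]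

lemma vecMulVec_mul_vecMulVec_gZero (v w : Fin n → ℝ) :
    Matrix.vecMulVec v z.2 * Matrix.vecMulVec (gZero g e z) w =
      (2 * energy g e z) • Matrix.vecMulVec v w := by
  rw [Matrix.vecMulVec_mul_vecMulVec, dotProduct_gZero]
  simp

lemma vecMulVec_gZero_mul_vecMulVec (v w : Fin n → ℝ) :
    Matrix.vecMulVec v (gZero g e z) * Matrix.vecMulVec z.2 w =
      (2 * energy g e z) • Matrix.vecMulVec v w := by
  rw [Matrix.vecMulVec_mul_vecMulVec, dotProduct_comm, dotProduct_gZero]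
  simp

include he hz

lemma gLow_mulVec_gZero : gLow g e z.1 *ᵥ gZero g e z = z.2 := by
  rw [gZero_eq, Matrix.mulVec_mulVec, gLow_mul_gUp g he hz, Matrix.one_mulVec]

lemma gLow_mul_vecMulVec (w : Fin n → ℝ) :
    gLow g e z.1 * Matrix.vecMulVec (gZero g e z) w = Matrix.vecMulVec z.2 w := by
  rw [Matrix.mul_vecMulVec, gLow_mulVec_gZero g he hz]

lemma vecMulVec_mul_gLow (w : Fin n → ℝ) :
    Matrix.vecMulVec w (gZero g e z) * gLow g e z.1 = Matrix.vecMulVec w z.2 := by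
  rw [Matrix.vecMulVec_mul, ← Matrix.mulVec_transpose, gLow_transpose, gLow_mulVec_gZero g he hz]

lemma lowMat_mul_upMat (a b a' b' : ℝ) : lowMat g e z a b * upMat g e z a' b' =
    (a * a') • 1 + (a * b' + b * a' + 2 * energy g e z * b * b') •
      Matrix.vecMulVec z.2 (gZero g e z) := by
  simp only [lowMat, upMat, add_mul, mul_add, smul_mul_assoc, mul_smul_comm,
    gLow_mul_gUp g he hz, gLow_mul_vecMulVec g he hz, vecMulVec_mul_gUp,
    vecMulVec_mul_vecMulVec_gZero]
  module

lemma upMat_mul_lowMat (a b a' b' : ℝ) : upMat g e z a b * lowMat g e z a' b' =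
    (a * a') • 1 + (a * b' + b * a' + 2 * energy g e z * b * b') •
      Matrix.vecMulVec (gZero g e z) z.2 := by
  simp only [lowMat, upMat, add_mul, mul_add, smul_mul_assoc, mul_smul_comm,
    gUp_mul_gLow g he hz, vecMulVec_mul_gLow g he hz, gUp_mul_vecMulVec,
    vecMulVec_gZero_mul_vecMulVec]
  module

lemma lowMat_mul_mixed (a b l m : ℝ) :
    lowMat g e z a b * (l • 1 + m • Matrix.vecMulVec (gZero g e z) z.2) =
      lowMat g e z (a * l) (a * m + b * l + 2 * energy g e z * b * m) := by
  simp only [lowMat, add_mul, mul_add, smul_mul_assoc, mul_smul_comm, mul_one,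
    gLow_mul_vecMulVec g he hz, vecMulVec_mul_vecMulVec_gZero]
  module

end

variable (A c : ℝ) (lam mu : ℝ → ℝ)

lemma J1_eq (e : Chart n M) (z : Phase n) (i j : Fin n) : J1 g A c lam e z i j =
    lowMat g e z (A * energy g e z * lam (energy g e z)) (coeffB1 A c lam (energy g e z)) i j := by
  rw [lowMat_apply]; rfl

lemma J2_eq (e : Chart n M) (z : Phase n) (i j : Fin n) : J2 g A c lam e z i j =
    upMat g e z (1 / (A * energy g e z * lam (energy g e z)))
      (coeffB2 A c lam (energy g e z)) i j := by
  rw [upMat_apply, coeffB2, neg_mul, neg_mul, ← sub_eq_add_neg]; rfl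

lemma G1_eq (e : Chart n M) (z : Phase n) (i j : Fin n) : G1 g A c lam mu e z i j =
    lowMat g e z (A * energy g e z * lam (energy g e z) ^ 2)
      (coeffD1 A c lam mu (energy g e z)) i j := by
  rw [lowMat_apply]; rfl

lemma G2_eq (e : Chart n M) (z : Phase n) (i j : Fin n) : G2 g A c lam mu e z i j =
    upMat g e z (1 / (A * energy g e z)) (coeffD2 A c lam mu (energy g e z)) i j := by
  rw [upMat_apply]; rfl

/-- The matrix of `J` from horizontal to vertical vectors. -/
def matJ1 (e : Chart n M) (z : Phase n) : Matrix (Fin n) (Fin n) ℝ :=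
  lowMat g e z (A * energy g e z * lam (energy g e z)) (coeffB1 A c lam (energy g e z))

/-- The matrix of `-J` from vertical to horizontal vectors. -/
def matJ2 (e : Chart n M) (z : Phase n) : Matrix (Fin n) (Fin n) ℝ :=
  upMat g e z (1 / (A * energy g e z * lam (energy g e z))) (coeffB2 A c lam (energy g e z))

/-- The matrix of `G` on horizontal vectors. -/
def matG1 (e : Chart n M) (z : Phase n) : Matrix (Fin n) (Fin n) ℝ :=
  lowMat g e z (A * energy g e z * lam (energy g e z) ^ 2) (coeffD1 A c lam mu (energy g e z))

/-- The matrix of `G` on vertical vectors. -/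
def matG2 (e : Chart n M) (z : Phase n) : Matrix (Fin n) (Fin n) ℝ :=
  upMat g e z (1 / (A * energy g e z)) (coeffD2 A c lam mu (energy g e z))

lemma matJ1_transpose (e : Chart n M) (z : Phase n) :
    (matJ1 g A c lam e z)ᵀ = matJ1 g A c lam e z :=
  lowMat_transpose _ _ _ _ _

lemma matJ2_transpose (e : Chart n M) (z : Phase n) :
    (matJ2 g A c lam e z)ᵀ = matJ2 g A c lam e z :=
  upMat_transpose _ _ _ _ _

lemma matG1_transpose (e : Chart n M) (z : Phase n) :
    (matG1 g A c lam mu e z)ᵀ = matG1 g A c lam mu e z :=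
  lowMat_transpose _ _ _ _ _

lemma matG2_transpose (e : Chart n M) (z : Phase n) :
    (matG2 g A c lam mu e z)ᵀ = matG2 g A c lam mu e z :=
  upMat_transpose _ _ _ _ _

lemma covDp_partialP (e : Chart n M) (z : Phase n) (i j : Fin n) :
    covDp g e z i (partialP j) = (1 : Matrix (Fin n) (Fin n) ℝ) i j := by
  simp [covDp_apply, partialP, Pi.single_apply, Matrix.one_apply]

lemma covDp_deltaQ (e : Chart n M) (z : Phase n) (i j : Fin n) :
    covDp g e z i (deltaQ g e z j) = 0 := by
  simp [covDp_apply, deltaQ, stdVec, christoffelZero_symm g e z i j]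

lemma natJ_fst (e : Chart n M) (z v : Phase n) :
    (natJ g A c lam e z v).1.ofLp = -(matJ2 g A c lam e z *ᵥ vertPart g e z v) := by
  funext k
  rw [← matJ2_transpose]
  have : (natJ g A c lam e z v).1.ofLp k = dq k (natJ g A c lam e z v) := rfl
  rw [this]
  simp only [natJ, sum_apply, map_sum, _root_.sub_apply, smul_apply, map_sub, map_smul,
    ContinuousLinearMap.smulRight_apply, dq_apply, partialP, deltaQ, stdVec, smul_eq_mul,
    Pi.neg_apply, Matrix.mulVec, dotProduct, matJ2, J2_eq, Matrix.transpose_apply, vertPart]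
  simp [Finset.sum_neg_distrib]

lemma vertPart_natJ (e : Chart n M) (z v : Phase n) :
    vertPart g e z (natJ g A c lam e z v) = matJ1 g A c lam e z *ᵥ v.1.ofLp := by
  funext k
  rw [← matJ1_transpose]
  simp only [vertPart, natJ, sum_apply, map_sum, _root_.sub_apply, smul_apply, map_sub,
    map_smul, ContinuousLinearMap.smulRight_apply, covDp_partialP, covDp_deltaQ, smul_eq_mul,
    Matrix.mulVec, dotProduct, matJ1, J1_eq, Matrix.transpose_apply, dq_apply]
  simp [Matrix.one_apply]

lemma natG_apply (e : Chart n M) (z u v : Phase n) :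
    natG g A c lam mu e z u v = u.1.ofLp ⬝ᵥ matG1 g A c lam mu e z *ᵥ v.1.ofLp
      + vertPart g e z u ⬝ᵥ matG2 g A c lam mu e z *ᵥ vertPart g e z v := by
  simp only [natG, sum_apply, _root_.add_apply, smul_apply, ContinuousLinearMap.smulRight_apply,
    smul_eq_mul, dotProduct, Matrix.mulVec, matG1, matG2, G1_eq, G2_eq, vertPart, dq_apply,
    Finset.mul_sum, ← Finset.sum_add_distrib]
  exact Finset.sum_congr rfl fun i _ => Finset.sum_congr rfl fun j _ => by ring

section

variable {A c lam mu} {e : Chart n M} (he : e ∈ IsManifold.maximalAtlas (𝓡 n) ∞ M)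
  {z : Phase n} (hz : z ∈ inducedTarget e) (hA : 0 < A) (hlam : ∀ t > 0, 0 < lam t)
  (hquot : ∀ t > 0, 0 < (2 * c - A ^ 2 * t * lam t ^ 2) / (lam t + 2 * t * deriv lam t))

include he hz hA hlam hquot

lemma matJ1_mul_matJ2 : matJ1 g A c lam e z * matJ2 g A c lam e z = 1 := by
  have ht := energy_pos g he hz
  have hl := hlam _ ht
  rw [matJ1, matJ2, lowMat_mul_upMat g he hz.1, coeff_J1_J2 hA ht hl (hquot _ ht),
    mul_one_div_cancel (by positivity)]
  simp

lemma matJ2_mul_matJ1 : matJ2 g A c lam e z * matJ1 g A c lam e z = 1 :=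
  mul_eq_one_comm.1 (matJ1_mul_matJ2 g he hz hA hlam hquot)

omit hlam in
/-- `φ = λ Dpᵢ ∧ dqⁱ + μ g^{0i} pⱼ Dpᵢ ∧ dqʲ` in matrix form. -/
lemma matG2_mul_matJ1 : matG2 g A c lam mu e z * matJ1 g A c lam e z =
    lam (energy g e z) • 1 + mu (energy g e z) • Matrix.vecMulVec (gZero g e z) z.2 := by
  have ht := energy_pos g he hz
  rw [matG2, matJ1, upMat_mul_lowMat g he hz.1, coeff_G2_J1 hA ht (hquot _ ht)]
  congr 2
  field_simp

omit hlam in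
lemma matG1_eq : matG1 g A c lam mu e z =
    matJ1 g A c lam e z * (matG2 g A c lam mu e z * matJ1 g A c lam e z) := by
  have ht := energy_pos g he hz
  rw [matG2_mul_matJ1 g he hz hA hquot, matJ1, lowMat_mul_mixed g he hz.1,
    coeff_J1_C hA ht (hquot _ ht), matG1]
  congr 1
  ring

lemma natJ_natJ (v : Phase n) : natJ g A c lam e z (natJ g A c lam e z v) = -v := by
  refine phase_ext (g := g) (e := e) (z := z) (fun i => ?_) (fun i => ?_)
  · have h := congrFun (natJ_fst g A c lam e z (natJ g A c lam e z v)) i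
    rw [vertPart_natJ, Matrix.mulVec_mulVec, matJ2_mul_matJ1 g he hz hA hlam hquot,
      Matrix.one_mulVec] at h
    exact h
  · have h := congrFun (vertPart_natJ g A c lam e z (natJ g A c lam e z v)) i
    rw [natJ_fst, Matrix.mulVec_neg, Matrix.mulVec_mulVec, matJ1_mul_matJ2 g he hz hA hlam hquot,
      Matrix.one_mulVec] at h
    rw [map_neg]
    exact h

lemma natG_natJ_natJ (u v : Phase n) :
    natG g A c lam mu e z (natJ g A c lam e z u) (natJ g A c lam e z v) =
      natG g A c lam mu e z u v := by
  have hS := matJ1_transpose g A c lam e z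
  have hT := matJ2_transpose g A c lam e z
  have hTS := matJ2_mul_matJ1 g he hz hA hlam hquot
  have hST := matJ1_mul_matJ2 g he hz hA hlam hquot
  rw [natG_apply, natG_apply, natJ_fst, natJ_fst, vertPart_natJ, vertPart_natJ,
    matG1_eq g he hz hA hquot]
  generalize matJ1 g A c lam e z = S at *
  generalize matJ2 g A c lam e z = T at *
  generalize matG2 g A c lam mu e z = N
  simp only [Matrix.mulVec_neg, neg_dotProduct, dotProduct_neg, neg_neg, Matrix.mulVec_mulVec]
  have h1 : ∀ (B C : Matrix (Fin n) (Fin n) ℝ) (x y : Fin n → ℝ), Bᵀ = B →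
      (B *ᵥ x) ⬝ᵥ C *ᵥ y = x ⬝ᵥ (B * C) *ᵥ y := by
    intro B C x y hB
    rw [← Matrix.mulVec_mulVec, Matrix.dotProduct_mulVec x, ← Matrix.mulVec_transpose, hB]
  rw [h1 T _ _ _ hT, h1 S _ _ _ hS]
  have h2 : T * (S * (N * S) * T) = N := by
    calc T * (S * (N * S) * T) = (T * S) * N * (S * T) := by noncomm_ring
      _ = N := by rw [hTS, hST, one_mul, mul_one]
  rw [h2, add_comm]

/-- The fundamental form is `λ Dpᵢ ∧ dqⁱ + μ dt ∧ pⱼ dqʲ`. -/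
lemma natG_natJ (u v : Phase n) : natG g A c lam mu e z u (natJ g A c lam e z v) =
    lam (energy g e z) * (vertPart g e z u ⬝ᵥ v.1.ofLp - vertPart g e z v ⬝ᵥ u.1.ofLp)
      + mu (energy g e z) * ((gZero g e z ⬝ᵥ vertPart g e z u) * (z.2 ⬝ᵥ v.1.ofLp)
        - (gZero g e z ⬝ᵥ vertPart g e z v) * (z.2 ⬝ᵥ u.1.ofLp)) := by
  have hS := matJ1_transpose g A c lam e z
  have hN := matG2_transpose g A c lam mu e z
  have hST := matJ1_mul_matJ2 g he hz hA hlam hquot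
  have hC := matG2_mul_matJ1 (mu := mu) g he hz hA hquot
  have h1 : matG1 g A c lam mu e z * matJ2 g A c lam e z =
      (matG2 g A c lam mu e z * matJ1 g A c lam e z)ᵀ := by
    rw [matG1_eq g he hz hA hquot, Matrix.transpose_mul, hS, hN, mul_assoc, mul_assoc, hST, mul_one]
  rw [natG_apply, natJ_fst, vertPart_natJ, Matrix.mulVec_neg, Matrix.mulVec_mulVec,
    Matrix.mulVec_mulVec, h1, hC]
  simp only [Matrix.transpose_add, Matrix.transpose_smul, Matrix.transpose_one,
    Matrix.transpose_vecMulVec, Matrix.add_mulVec, Matrix.smul_mulVec, Matrix.one_mulVec,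
    Matrix.vecMulVec_mulVec, dotProduct_add, dotProduct_smul, dotProduct_neg, smul_eq_mul,
    MulOpposite.smul_eq_mul_unop, MulOpposite.unop_op]
  rw [dotProduct_comm u.1.ofLp, dotProduct_comm u.1.ofLp, dotProduct_comm _ (gZero g e z)]
  simp
  ring

lemma natG_pos (hmu : ∀ t > 0, 0 < lam t + 2 * t * mu t) {v : Phase n} (hv : v ≠ 0) :
    0 < natG g A c lam mu e z v v := by
  have ht := energy_pos g he hz
  have hl := hlam _ ht
  have hlow : ∀ x : Fin n → ℝ, x ≠ 0 → 0 < x ⬝ᵥ matG1 g A c lam mu e z *ᵥ x := by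
    intro x hx
    have h := quadraticForm_pos (fun x hx => gLow_pos g he hz.1 (x := x) hx)
      (gLow_transpose g e z.1) (v := gZero g e z) (t := energy g e z)
      (by rw [gLow_mulVec_gZero g he hz.1, dotProduct_comm, dotProduct_gZero]) ht
      (by positivity : 0 < A * energy g e z * lam (energy g e z) ^ 2)
      (coeff_G1_pos hA ht (hquot _ ht) (hmu _ ht)) hx
    rw [Matrix.dotProduct_mulVec (gZero g e z), ← Matrix.mulVec_transpose, gLow_transpose,
      gLow_mulVec_gZero g he hz.1] at h
    convert h using 1
    simp only [matG1, lowMat, Matrix.add_mulVec, Matrix.smul_mulVec, Matrix.vecMulVec_mulVec,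
      dotProduct_add, dotProduct_smul, smul_eq_mul, MulOpposite.smul_eq_mul_unop,
      MulOpposite.unop_op, dotProduct_comm x z.2]
    ring
  have hup : ∀ x : Fin n → ℝ, x ≠ 0 → 0 < x ⬝ᵥ matG2 g A c lam mu e z *ᵥ x := by
    intro x hx
    have h := quadraticForm_pos (fun x hx => gUp_pos g he hz.1 (x := x) hx)
      (gUp_transpose g e z.1) (v := z.2) (t := energy g e z)
      (by rw [← gZero_eq, dotProduct_gZero]) ht
      (by positivity : 0 < 1 / (A * energy g e z))
      (coeff_G2_pos hA ht (hquot _ ht) (hmu _ ht)) hx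
    rw [Matrix.dotProduct_mulVec z.2, ← Matrix.mulVec_transpose, gUp_transpose,
      ← gZero_eq] at h
    convert h using 1
    simp only [matG2, upMat, Matrix.add_mulVec, Matrix.smul_mulVec, Matrix.vecMulVec_mulVec,
      dotProduct_add, dotProduct_smul, smul_eq_mul, MulOpposite.smul_eq_mul_unop,
      MulOpposite.unop_op, dotProduct_comm x (gZero g e z)]
    ring
  rw [natG_apply]
  by_cases h1 : v.1.ofLp = 0
  · have h2 : vertPart g e z v ≠ 0 := by
      intro h2
      refine hv (phase_ext (g := g) (e := e) (z := z) (congrFun h1) fun i => ?_)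
      rw [map_zero]
      exact congrFun h2 i
    have := hup _ h2
    rw [h1]
    simpa using this
  · have h3 := hlow _ h1
    by_cases h2 : vertPart g e z v = 0
    · rw [h2]
      simpa using h3
    · exact add_pos h3 (hup _ h2)

end

lemma natG_symm (e : Chart n M) (z u v : Phase n) :
    natG g A c lam mu e z u v = natG g A c lam mu e z v u := by
  have h : ∀ (B : Matrix (Fin n) (Fin n) ℝ) (x y : Fin n → ℝ), Bᵀ = B →
      x ⬝ᵥ B *ᵥ y = y ⬝ᵥ B *ᵥ x := by
    intro B x y hB
    rw [Matrix.dotProduct_mulVec, ← Matrix.mulVec_transpose, hB, dotProduct_comm]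
  rw [natG_apply, natG_apply, h _ _ _ (matG1_transpose g A c lam mu e z),
    h _ _ _ (matG2_transpose g A c lam mu e z)]

end Metric

/-! ### The Nijenhuis tensor -/

section Nijenhuis

variable {V : Type*} [NormedAddCommGroup V] [NormedSpace ℝ V] {J : V → V →L[ℝ] V} {z : V}

/-- The value of the Nijenhuis tensor on two vectors at `z`, in terms of the derivative of `J`. -/
def nijenhuisTensor (J : V → V →L[ℝ] V) (z : V) : V →ₗ[ℝ] V →ₗ[ℝ] V :=
  LinearMap.mk₂ ℝ (fun x y => fderiv ℝ J z (J z x) y - fderiv ℝ J z (J z y) x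
      + J z (fderiv ℝ J z y x) - J z (fderiv ℝ J z x y))
    (fun x x' y => by simp only [map_add, _root_.add_apply]; abel)
    (fun r x y => by simp only [map_smul, smul_apply, smul_add, smul_sub])
    (fun x y y' => by simp only [map_add, _root_.add_apply]; abel)
    (fun r x y => by simp only [map_smul, smul_apply, smul_add, smul_sub])

lemma nijenhuisTensor_apply (x y : V) : nijenhuisTensor J z x y =
    fderiv ℝ J z (J z x) y - fderiv ℝ J z (J z y) x
      + J z (fderiv ℝ J z y x) - J z (fderiv ℝ J z x y) := rfl

lemma nijenhuisTensor_swap (x y : V) :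
    nijenhuisTensor J z x y = -nijenhuisTensor J z y x := by
  simp only [nijenhuisTensor_apply]
  abel

lemma nijenhuis_eq (hJ : DifferentiableAt ℝ J z) (hJ2 : ∀ v, J z (J z v) = -v) {X Y : V → V}
    (hX : DifferentiableAt ℝ X z) (hY : DifferentiableAt ℝ Y z) :
    nijenhuis J X Y z = nijenhuisTensor J z (X z) (Y z) := by
  have h : ∀ {X : V → V}, DifferentiableAt ℝ X z → ∀ u, fderiv ℝ (fun y => J y (X y)) z u =
      fderiv ℝ J z u (X z) + J z (fderiv ℝ X z u) := by
    intro X hX u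
    rw [fderiv_clm_apply hJ hX]
    simp [add_comm]
  simp only [nijenhuis, VectorField.lieBracket, h hX, h hY, nijenhuisTensor_apply, map_sub, map_add,
    hJ2]
  abel

/-- The Nijenhuis tensor is `J`-antilinear. -/
lemma nijenhuisTensor_J (hJ : DifferentiableAt ℝ J z)
    (hJ2 : ∀ᶠ y in nhds z, ∀ v, J y (J y v) = -v) (x y : V) :
    nijenhuisTensor J z (J z x) y = -J z (nijenhuisTensor J z x y) := by
  have hz := hJ2.self_of_nhds
  have h : ∀ u v, fderiv ℝ J z u (J z v) = -J z (fderiv ℝ J z u v) := by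
    intro u v
    have h1 : (fun y => J y (J y v)) =ᶠ[nhds z] fun _ => -v := hJ2.mono fun y hy => hy v
    have h2 := h1.fderiv_eq (𝕜 := ℝ)
    rw [fderiv_clm_apply hJ (hJ.clm_apply (differentiableAt_const v)),
      fderiv_clm_apply hJ (differentiableAt_const v)] at h2
    have h3 := congrArg (fun L => L u) h2
    simp at h3
    rw [eq_neg_iff_add_eq_zero, add_comm]
    exact h3
  simp only [nijenhuisTensor_apply, hz, h, map_neg, map_sub, map_add, _root_.neg_apply]
  abel

lemma contDiffAt_smul_smulRight {W : Type*} [NormedAddCommGroup W] [NormedSpace ℝ W]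
    {f : V → ℝ} {α : V → V →L[ℝ] ℝ} {w : V → W} (hf : ContDiffAt ℝ ∞ f z)
    (hα : ContDiffAt ℝ ∞ α z) (hw : ContDiffAt ℝ ∞ w z) :
    ContDiffAt ℝ ∞ (fun y => f y • (α y).smulRight (w y)) z :=
  hf.smul (hα.smulRight hw)

end Nijenhuis

section Metric

variable {n : ℕ} {M : Type*} [TopologicalSpace M] [ChartedSpace (EuclideanSpace ℝ (Fin n)) M]
  [IsManifold (𝓡 n) ∞ M] (g : Metric n M)

section

variable {e : Chart n M} (he : e ∈ IsManifold.maximalAtlas (𝓡 n) ∞ M)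
  {z : Phase n} (hz : z ∈ inducedTarget e)

include he hz

lemma contDiffAt_lowMat {a b : ℝ → ℝ} (ha : ContDiffOn ℝ ∞ a (Set.Ioi 0))
    (hb : ContDiffOn ℝ ∞ b (Set.Ioi 0)) (i j : Fin n) :
    ContDiffAt ℝ ∞ (fun y => lowMat g e y (a (energy g e y)) (b (energy g e y)) i j) z := by
  simp only [lowMat_apply]
  exact ((contDiffAt_comp_energy g he hz ha).mul
    (contDiffAt_comp_fst (contDiffAt_gLow g he hz.1 i j))).add
    (((contDiffAt_comp_energy g he hz hb).mul (contDiffAt_snd_apply i z)).mul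
      (contDiffAt_snd_apply j z))

lemma contDiffAt_upMat {a b : ℝ → ℝ} (ha : ContDiffOn ℝ ∞ a (Set.Ioi 0))
    (hb : ContDiffOn ℝ ∞ b (Set.Ioi 0)) (i j : Fin n) :
    ContDiffAt ℝ ∞ (fun y => upMat g e y (a (energy g e y)) (b (energy g e y)) i j) z := by
  simp only [upMat_apply]
  exact ((contDiffAt_comp_energy g he hz ha).mul
    (contDiffAt_comp_fst (contDiffAt_gUp g he hz.1 i j))).add
    (((contDiffAt_comp_energy g he hz hb).mul (contDiffAt_gZero g he hz.1 i)).mul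
      (contDiffAt_gZero g he hz.1 j))

lemma fderiv_lowMat {a b : ℝ → ℝ} (ha : ContDiffOn ℝ ∞ a (Set.Ioi 0))
    (hb : ContDiffOn ℝ ∞ b (Set.Ioi 0)) (i j : Fin n) (u : Phase n) :
    fderiv ℝ (fun y => lowMat g e y (a (energy g e y)) (b (energy g e y)) i j) z u =
      deriv a (energy g e z) * fderiv ℝ (energy g e) z u * gLow g e z.1 i j
        + a (energy g e z) * ∑ k, u.1 k * pderiv k (fun q => gLow g e q i j) z.1
        + deriv b (energy g e z) * fderiv ℝ (energy g e) z u * (z.2 i * z.2 j)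
        + b (energy g e z) * (u.2 i * z.2 j + z.2 i * u.2 j) := by
  have hE := ((contDiffAt_energy g he hz.1).differentiableAt (by simp)).hasFDerivAt
  have hcomp : ∀ {f : ℝ → ℝ}, ContDiffOn ℝ ∞ f (Set.Ioi 0) →
      HasFDerivAt (fun y => f (energy g e y))
        (deriv f (energy g e z) • fderiv ℝ (energy g e) z) z := by
    intro f hf
    have := ((hf.contDiffAt (Ioi_mem_nhds (energy_pos g he hz))).differentiableAt
      (by simp)).hasDerivAt
    exact this.comp_hasFDerivAt z hE
  have hg := contDiffAt_comp_fst (contDiffAt_gLow g he hz.1 i j)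
  have hp := fun i => ((contDiffAt_snd_apply i z).differentiableAt (by simp)).hasFDerivAt
  have h := ((hcomp ha).mul (hg.differentiableAt (by simp)).hasFDerivAt).add
    (((hcomp hb).mul (hp i)).mul (hp j))
  simp only [lowMat_apply]
  refine (congrArg (fun L => L u) h.fderiv).trans ?_
  simp only [smul_apply, _root_.add_apply, smul_eq_mul, fderiv_snd_apply,
    fderiv_comp_fst (contDiffAt_gLow g he hz.1 _ _), Pi.mul_apply]
  ring

omit hz in
lemma fderiv_christoffelZero (hz : z.1 ∈ e.target) (i j : Fin n) (u : Phase n) :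
    fderiv ℝ (fun y => christoffelZero g e y i j) z u =
      ∑ k, (u.2 k * christoffel g e k i j z.1
        + z.2 k * ∑ l, u.1 l * pderiv l (christoffel g e k i j) z.1) := by
  have hp := fun i => ((contDiffAt_snd_apply i z).differentiableAt (by simp)).hasFDerivAt
  have hΓ := fun k => ((contDiffAt_comp_fst (contDiffAt_christoffel g he hz k i j)).differentiableAt
    (by simp)).hasFDerivAt
  have h := HasFDerivAt.fun_sum (u := Finset.univ) fun k _ => (hp k).mul (hΓ k)
  unfold christoffelZero
  refine (congrArg (fun L => L u) h.fderiv).trans ?_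
  simp only [smul_apply, sum_apply, _root_.add_apply, smul_eq_mul, fderiv_snd_apply,
    fderiv_comp_fst (contDiffAt_christoffel g he hz _ _ _)]
  exact Finset.sum_congr rfl fun k _ => by ring

end

lemma hasFDerivAt_const_prodMk {z : Phase n} (a : EuclideanSpace ℝ (Fin n))
    {f : Phase n → Fin n → ℝ} (hf : ∀ k, DifferentiableAt ℝ (fun y => f y k) z) :
    HasFDerivAt (fun y => ((a, f y) : Phase n))
      ((0 : Phase n →L[ℝ] EuclideanSpace ℝ (Fin n)).prod
        (ContinuousLinearMap.pi fun k => fderiv ℝ (fun y => f y k) z)) z :=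
  (hasFDerivAt_const a z).prodMk (hasFDerivAt_pi.2 fun k => (hf k).hasFDerivAt)

lemma lieBracket_const_prodMk {z : Phase n} (a b : EuclideanSpace ℝ (Fin n))
    {f f' : Phase n → Fin n → ℝ} (hf : ∀ k, DifferentiableAt ℝ (fun y => f y k) z)
    (hf' : ∀ k, DifferentiableAt ℝ (fun y => f' y k) z) :
    VectorField.lieBracket ℝ (fun y => ((a, f y) : Phase n)) (fun y => (b, f' y)) z =
      (0, fun k => fderiv ℝ (fun y => f' y k) z (a, f z)
        - fderiv ℝ (fun y => f y k) z (b, f' z)) := by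
  rw [VectorField.lieBracket, (hasFDerivAt_const_prodMk a hf).fderiv,
    (hasFDerivAt_const_prodMk b hf').fderiv]
  ext k <;> simp

variable (A c : ℝ) (lam mu : ℝ → ℝ)

lemma natJ_deltaQ (e : Chart n M) (z : Phase n) (i : Fin n) :
    natJ g A c lam e z (deltaQ g e z i) = (0, fun k => matJ1 g A c lam e z i k) := by
  have hv : vertPart g e z (deltaQ g e z i) = 0 := funext fun k => covDp_deltaQ g e z k i
  refine phase_ext (g := g) (e := e) (z := z) (fun k => ?_) (fun k => ?_)
  · have := congrFun (natJ_fst g A c lam e z (deltaQ g e z i)) k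
    rw [hv] at this
    simpa using this
  · have := congrFun (vertPart_natJ g A c lam e z (deltaQ g e z i)) k
    rw [covDp_apply (u := (0, _)), ← matJ1_transpose]
    simpa [vertPart, deltaQ, stdVec] using this

/-- The horizontal vector with components `a`. -/
def horiz (e : Chart n M) (z : Phase n) (a : Fin n → ℝ) : Phase n := ∑ i, a i • deltaQ g e z i

lemma horiz_fst (e : Chart n M) (z : Phase n) (a : Fin n → ℝ) :
    (horiz g e z a).1.ofLp = a := by
  funext k
  change dq k (horiz g e z a) = a k
  simp [horiz, dq_apply, deltaQ, stdVec]

lemma vertPart_horiz (e : Chart n M) (z : Phase n) (a : Fin n → ℝ) :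
    vertPart g e z (horiz g e z a) = 0 := by
  funext k
  simp [vertPart, horiz, covDp_deltaQ]

/-- The differential equation for the coefficients of `J` that is equivalent to
integrability. -/
lemma coeff_integrability {A c : ℝ} {lam : ℝ → ℝ} {t : ℝ} (hA : 0 < A) (ht : 0 < t)
    (hlam' : ContDiffOn ℝ ∞ lam (Set.Ioi 0))
    (hquot : ∀ t > 0, 0 < (2 * c - A ^ 2 * t * lam t ^ 2) / (lam t + 2 * t * deriv lam t)) :
    (A * t * lam t + 2 * t * coeffB1 A c lam t) * deriv (fun t => A * t * lam t) t
      - A * t * lam t * coeffB1 A c lam t = c := by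
  have hl := ((hlam'.contDiffAt (Ioi_mem_nhds ht)).differentiableAt (by simp)).hasDerivAt
  have h : HasDerivAt (fun t => A * t * lam t) (A * 1 * lam t + A * t * deriv lam t) t :=
    ((hasDerivAt_id t).const_mul A).mul hl
  have h1 := denominator_ne_zero (hquot t ht)
  have h2 : A * 1 * lam t + A * t * deriv lam t =
      A * (lam t + (lam t + 2 * t * deriv lam t)) / 2 := by ring
  rw [h.deriv, coeffB1, numerator_relation, h2]
  generalize lam t + 2 * t * deriv lam t = L at h1 ⊢
  generalize lam t = l
  field_simp
  ring

section

variable {A c lam mu} {e : Chart n M} (he : e ∈ IsManifold.maximalAtlas (𝓡 n) ∞ M)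
  {z : Phase n} (hz : z ∈ inducedTarget e) (hA : 0 < A) (hlam : ∀ t > 0, 0 < lam t)
  (hlam' : ContDiffOn ℝ ∞ lam (Set.Ioi 0)) (hmu' : ContDiffOn ℝ ∞ mu (Set.Ioi 0))
  (hquot : ∀ t > 0, 0 < (2 * c - A ^ 2 * t * lam t ^ 2) / (lam t + 2 * t * deriv lam t))

lemma contDiffOn_deriv_Ioi {f : ℝ → ℝ} (hf : ContDiffOn ℝ ∞ f (Set.Ioi 0)) :
    ContDiffOn ℝ ∞ (deriv f) (Set.Ioi 0) :=
  hf.deriv_of_isOpen isOpen_Ioi (by simp)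

include hA hlam hlam' hquot

omit hlam in
lemma contDiffOn_coeffB1 : ContDiffOn ℝ ∞ (coeffB1 A c lam) (Set.Ioi 0) := by
  have hd := contDiffOn_deriv_Ioi hlam'
  unfold coeffB1
  refine ContDiffOn.div (by fun_prop) (by fun_prop) fun t ht => ?_
  exact mul_ne_zero (mul_ne_zero hA.ne' (ne_of_gt ht)) (denominator_ne_zero (hquot t ht))

lemma contDiffOn_coeffB2 : ContDiffOn ℝ ∞ (coeffB2 A c lam) (Set.Ioi 0) := by
  have hd := contDiffOn_deriv_Ioi hlam'
  unfold coeffB2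
  refine (ContDiffOn.div (by fun_prop) (by fun_prop) fun t ht => ?_).neg
  have := hlam t ht
  have ht' : 0 < t := ht
  exact mul_ne_zero (by positivity) (numerator_ne_zero (hquot t ht))

omit hA hlam hlam' hquot in
lemma contDiffOn_coeffA1 (hlam' : ContDiffOn ℝ ∞ lam (Set.Ioi 0)) :
    ContDiffOn ℝ ∞ (fun t => A * t * lam t) (Set.Ioi 0) := by
  fun_prop

omit hquot in
lemma contDiffOn_coeffA2 : ContDiffOn ℝ ∞ (fun t => 1 / (A * t * lam t)) (Set.Ioi 0) := by
  refine ContDiffOn.div (by fun_prop) (by fun_prop) fun t ht => ?_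
  have := hlam t ht
  have ht' : 0 < t := ht
  positivity

omit hlam in
include hmu' in
lemma contDiffOn_coeffD1 : ContDiffOn ℝ ∞ (coeffD1 A c lam mu) (Set.Ioi 0) := by
  have hd := contDiffOn_deriv_Ioi hlam'
  unfold coeffD1
  refine ContDiffOn.div (by fun_prop) (by fun_prop) fun t ht => ?_
  exact mul_ne_zero (mul_ne_zero hA.ne' (ne_of_gt ht)) (denominator_ne_zero (hquot t ht))

omit hlam in
include hmu' in
lemma contDiffOn_coeffD2 : ContDiffOn ℝ ∞ (coeffD2 A c lam mu) (Set.Ioi 0) := by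
  have hd := contDiffOn_deriv_Ioi hlam'
  unfold coeffD2
  refine ContDiffOn.div (by fun_prop) (by fun_prop) fun t ht => ?_
  have ht' : 0 < t := ht
  exact mul_ne_zero (by positivity) (numerator_ne_zero (hquot t ht))

include he hz

lemma contDiffAt_natJ : ContDiffAt ℝ ∞ (natJ g A c lam e) z := by
  unfold natJ
  simp only [J1_eq, J2_eq]
  have h1 := contDiffAt_lowMat g he hz (contDiffOn_coeffA1 (A := A) hlam')
    (contDiffOn_coeffB1 hA hlam' hquot)
  have h2 := contDiffAt_upMat g he hz (contDiffOn_coeffA2 hA hlam hlam')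
    (contDiffOn_coeffB2 hA hlam hlam' hquot)
  exact ContDiffAt.sum fun i _ => ContDiffAt.sum fun j _ =>
    (contDiffAt_smul_smulRight (h1 i j) contDiffAt_const contDiffAt_const).sub
      (contDiffAt_smul_smulRight (h2 i j) (contDiffAt_covDp g he hz.1 i)
        (contDiffAt_deltaQ g he hz.1 j))

omit hlam in
include hmu' in
lemma contDiffAt_natG : ContDiffAt ℝ ∞ (natG g A c lam mu e) z := by
  unfold natG
  simp only [G1_eq, G2_eq]
  have h1 := contDiffAt_lowMat g he hz (a := fun t => A * t * lam t ^ 2) (by fun_prop)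
    (contDiffOn_coeffD1 hA hlam' hmu' hquot)
  have h2 := contDiffAt_upMat g he hz (a := fun t => 1 / (A * t))
    (ContDiffOn.div (by fun_prop) (by fun_prop) fun t ht => mul_ne_zero hA.ne' (ne_of_gt ht))
    (contDiffOn_coeffD2 hA hlam' hmu' hquot)
  exact ContDiffAt.sum fun i _ => ContDiffAt.sum fun j _ =>
    (contDiffAt_smul_smulRight (h1 i j) contDiffAt_const contDiffAt_const).add
      (contDiffAt_smul_smulRight (h2 i j) (contDiffAt_covDp g he hz.1 i)
        (contDiffAt_covDp g he hz.1 j))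

omit hA hlam hlam' hquot in
/-- `[δ/δqⁱ, δ/δqʲ] = c (pᵢ g_{jk} - pⱼ g_{ik}) ∂/∂pₖ` in constant curvature. -/
lemma lieBracket_deltaQ (hc : HasConstantSectionalCurvature g c) (i j : Fin n) :
    VectorField.lieBracket ℝ (fun y => deltaQ g e y i) (fun y => deltaQ g e y j) z =
      (0, fun k => c * (z.2 i * gLow g e z.1 j k - z.2 j * gLow g e z.1 i k)) := by
  unfold deltaQ
  rw [lieBracket_const_prodMk _ _
    (fun k => (contDiffAt_christoffelZero g he hz.1 i k).differentiableAt (by simp))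
    (fun k => (contDiffAt_christoffelZero g he hz.1 j k).differentiableAt (by simp))]
  congr 1
  funext k
  have hstd : ∀ (i : Fin n) (f : Fin n → ℝ), ∑ l, (stdVec i : EuclideanSpace ℝ (Fin n)) l * f l
      = f i := by
    intro i f
    simp [stdVec]
  simp only [fderiv_christoffelZero g he hz.1, hstd]
  have hR : ∑ l, z.2 l * curvature g e l k i j z.1 =
      c * (z.2 i * gLow g e z.1 j k - z.2 j * gLow g e z.1 i k) := by
    simp only [curvature_of_constant g he hz.1 hc, gLow_symm g e z.1 k, Matrix.one_apply]
    have : ∀ l, z.2 l * (c * ((if l = i then 1 else 0) * gLow g e z.1 j k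
        - (if l = j then 1 else 0) * gLow g e z.1 i k)) =
        (if l = i then z.2 l * c * gLow g e z.1 j k else 0)
          - (if l = j then z.2 l * c * gLow g e z.1 i k else 0) := by
      intro l
      split_ifs <;> ring
    simp only [this, Finset.sum_sub_distrib, Finset.sum_ite_eq', Finset.mem_univ, if_true]
    ring
  rw [← hR]
  have h1 : ∀ i j, ∑ m, christoffelZero g e z i m * christoffel g e m j k z.1 =
      ∑ l, z.2 l * ∑ m, christoffel g e l i m z.1 * christoffel g e m j k z.1 := by
    intro i j
    simp only [christoffelZero, Finset.mul_sum, Finset.sum_mul]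
    rw [Finset.sum_comm]
    exact Finset.sum_congr rfl fun l _ => Finset.sum_congr rfl fun m _ => by ring
  simp only [Finset.sum_add_distrib, h1, curvature, Finset.sum_sub_distrib, mul_add, mul_sub]
  ring

omit hlam in
/-- `[Jδ/δqⁱ, δ/δqʲ] + [δ/δqⁱ, Jδ/δqʲ] = 0`, since the tensors `g` and `p` that make up `J` are
parallel. -/
lemma lieBracket_mixed (i j : Fin n) :
    VectorField.lieBracket ℝ (fun y => ((0, fun k => matJ1 g A c lam e y i k) : Phase n))
        (fun y => deltaQ g e y j) z
      + VectorField.lieBracket ℝ (fun y => deltaQ g e y i)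
        (fun y => (0, fun k => matJ1 g A c lam e y j k)) z = 0 := by
  have hA1 := contDiffOn_coeffA1 (A := A) hlam'
  have hB1 := contDiffOn_coeffB1 hA hlam' hquot
  have hS : ∀ i k, DifferentiableAt ℝ (fun y => matJ1 g A c lam e y i k) z :=
    fun i k => (contDiffAt_lowMat g he hz hA1 hB1 i k).differentiableAt (by simp)
  have hd : ∀ i, fderiv ℝ (energy g e) z (deltaQ g e z i) = 0 := by
    intro i
    simp [fderiv_energy g he hz.1, covDp_deltaQ]
  have hstd : ∀ (i : Fin n) (f : Fin n → ℝ), ∑ l, (stdVec i : EuclideanSpace ℝ (Fin n)) l * f l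
      = f i := by
    intro i f
    simp [stdVec]
  -- the derivative of the components of `J` along `δ/δqⁱ`
  have hDS : ∀ i j k, fderiv ℝ (fun y => matJ1 g A c lam e y j k) z (deltaQ g e z i) =
      A * energy g e z * lam (energy g e z) *
          ∑ m, (gLow g e z.1 j m * christoffel g e m i k z.1
            + christoffel g e m i j z.1 * gLow g e z.1 m k)
        + coeffB1 A c lam (energy g e z) * (christoffelZero g e z i j * z.2 k
          + z.2 j * christoffelZero g e z i k) := by
    intro i j k
    have h := fderiv_lowMat g he hz hA1 hB1 j k (deltaQ g e z i)
    rw [hd] at h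
    refine h.trans ?_
    have h2 := congrFun (congrFun (mderiv_gLow g he hz.1 i) j) k
    simp only [mderiv, connMatrix, Matrix.of_apply, Matrix.add_apply, Matrix.mul_apply,
      Matrix.transpose_apply] at h2
    simp only [deltaQ, hstd, h2, Finset.sum_add_distrib]
    ring
  have hDE : ∀ i j k, fderiv ℝ (fun y => christoffelZero g e y j k) z
      (0, fun k => matJ1 g A c lam e z i k) =
      A * energy g e z * lam (energy g e z) * ∑ m, gLow g e z.1 i m * christoffel g e m j k z.1
        + coeffB1 A c lam (energy g e z) * z.2 i * christoffelZero g e z j k := by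
    intro i j k
    rw [fderiv_christoffelZero g he hz.1]
    simp only [matJ1, lowMat_apply, christoffelZero, Finset.mul_sum, ← Finset.sum_add_distrib]
    exact Finset.sum_congr rfl fun m _ => by simp; ring
  unfold deltaQ
  rw [lieBracket_const_prodMk _ _ (hS i)
    (fun k => (contDiffAt_christoffelZero g he hz.1 j k).differentiableAt (by simp)),
    lieBracket_const_prodMk _ _
      (fun k => (contDiffAt_christoffelZero g he hz.1 i k).differentiableAt (by simp)) (hS j)]
  refine Prod.ext (add_zero _) (funext fun k => ?_)
  have h1 := hDS i j k
  have h2 := hDS j i k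
  unfold deltaQ at h1 h2
  simp only [Prod.snd_add, Pi.add_apply, h1, h2, hDE, Finset.sum_add_distrib,
    christoffel_symm g e _ j i, christoffelZero_symm g e z j i, Prod.snd_zero, Pi.zero_apply]
  ring

omit hlam in
/-- `[Jδ/δqⁱ, Jδ/δqʲ] = c (pᵢ g_{jk} - pⱼ g_{ik}) ∂/∂pₖ`. -/
lemma lieBracket_vertical (i j : Fin n) :
    VectorField.lieBracket ℝ (fun y => ((0, fun k => matJ1 g A c lam e y i k) : Phase n))
        (fun y => (0, fun k => matJ1 g A c lam e y j k)) z =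
      (0, fun k => c * (z.2 i * gLow g e z.1 j k - z.2 j * gLow g e z.1 i k)) := by
  have hA1 := contDiffOn_coeffA1 (A := A) hlam'
  have hB1 := contDiffOn_coeffB1 hA hlam' hquot
  have hS : ∀ i k, DifferentiableAt ℝ (fun y => matJ1 g A c lam e y i k) z :=
    fun i k => (contDiffAt_lowMat g he hz hA1 hB1 i k).differentiableAt (by simp)
  rw [lieBracket_const_prodMk _ _ (hS i) (hS j)]
  congr 1
  funext k
  have hd : ∀ i, fderiv ℝ (energy g e) z (0, fun k => matJ1 g A c lam e z i k) =
      (A * energy g e z * lam (energy g e z)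
        + 2 * energy g e z * coeffB1 A c lam (energy g e z)) * z.2 i := by
    intro i
    have h1 := congrFun (gLow_mulVec_gZero g he hz.1) i
    have h2 := dotProduct_gZero g e z
    simp only [Matrix.mulVec, dotProduct] at h1 h2
    rw [fderiv_energy g he hz.1, ← h2, add_mul]
    rw [show ∀ a b : ℝ, a * z.2 i + b * z.2 i = a * (∑ m, gLow g e z.1 i m * gZero g e z m)
      + b * z.2 i from fun a b => by rw [h1]]
    simp only [covDp_apply, matJ1, lowMat_apply, Finset.mul_sum, Finset.sum_mul,
      ← Finset.sum_add_distrib]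
    exact Finset.sum_congr rfl fun m _ => by simp; ring
  have hDS : ∀ i j, fderiv ℝ (fun y => matJ1 g A c lam e y j k) z
      (0, fun k => matJ1 g A c lam e z i k) = _ :=
    fun i j => fderiv_lowMat g he hz hA1 hB1 j k _
  rw [hDS, hDS, hd, hd]
  have h1 : ∀ i j, matJ1 g A c lam e z i j = A * energy g e z * lam (energy g e z) *
      gLow g e z.1 i j + coeffB1 A c lam (energy g e z) * z.2 i * z.2 j :=
    fun i j => lowMat_apply _ _ _ _ _ _ _
  simp only [h1, PiLp.zero_apply, zero_mul, Finset.sum_const_zero, gLow_symm g e z.1 j i]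
  linear_combination (z.2 i * gLow g e z.1 j k - z.2 j * gLow g e z.1 i k) *
    coeff_integrability hA (energy_pos g he hz) hlam' hquot

omit hlam' in
/-- Every tangent vector is `X + JY` with `X` and `Y` horizontal. -/
lemma exists_horiz (v : Phase n) : ∃ a b : Fin n → ℝ,
    v = horiz g e z a + natJ g A c lam e z (horiz g e z b) := by
  refine ⟨v.1.ofLp, matJ2 g A c lam e z *ᵥ vertPart g e z v,
    phase_ext (g := g) (e := e) (z := z) (fun k => ?_) (fun k => ?_)⟩
  · have h := congrFun (natJ_fst g A c lam e z
      (horiz g e z (matJ2 g A c lam e z *ᵥ vertPart g e z v))) k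
    rw [vertPart_horiz, Matrix.mulVec_zero, neg_zero] at h
    have h1 := congrFun (horiz_fst g e z v.1.ofLp) k
    rw [Prod.fst_add, PiLp.add_apply, h, h1]
    simp
  · have h := congrFun (vertPart_natJ g A c lam e z
      (horiz g e z (matJ2 g A c lam e z *ᵥ vertPart g e z v))) k
    rw [horiz_fst, Matrix.mulVec_mulVec, matJ1_mul_matJ2 g he hz hA hlam hquot,
      Matrix.one_mulVec] at h
    have h1 := congrFun (vertPart_horiz g e z v.1.ofLp) k
    simp only [vertPart, Pi.zero_apply] at h h1
    rw [map_add, h, h1, zero_add]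

/-- `J` is integrable. -/
lemma nijenhuisTensor_natJ (hc : HasConstantSectionalCurvature g c) (u v : Phase n) :
    nijenhuisTensor (natJ g A c lam e) z u v = 0 := by
  have hJ := (contDiffAt_natJ g he hz hA hlam hlam' hquot).differentiableAt (by simp)
  have hJ2 : ∀ᶠ y in nhds z, ∀ v, natJ g A c lam e y (natJ g A c lam e y v) = -v := by
    filter_upwards [(isOpen_inducedTarget he).mem_nhds hz] with y hy v
    exact natJ_natJ g he hy hA hlam hquot v
  have hij : ∀ i j,
      nijenhuisTensor (natJ g A c lam e) z (deltaQ g e z i) (deltaQ g e z j) = 0 := by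
    intro i j
    have h := nijenhuis_eq hJ hJ2.self_of_nhds
      ((contDiffAt_deltaQ g he hz.1 i).differentiableAt (by simp))
      ((contDiffAt_deltaQ g he hz.1 j).differentiableAt (by simp))
    rw [← h]
    have hmixed := lieBracket_mixed g he hz hA hlam' hquot i j
    simp only [nijenhuis, natJ_deltaQ]
    rw [lieBracket_vertical g he hz hA hlam' hquot, lieBracket_deltaQ g he hz hc,
      eq_neg_of_add_eq_zero_left hmixed, map_neg]
    abel
  have hhor : ∀ a b,
      nijenhuisTensor (natJ g A c lam e) z (horiz g e z a) (horiz g e z b) = 0 := by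
    intro a b
    simp [horiz, hij]
  have hJhor : ∀ a b, nijenhuisTensor (natJ g A c lam e) z
      (natJ g A c lam e z (horiz g e z a)) (horiz g e z b) = 0 := by
    intro a b
    rw [nijenhuisTensor_J hJ hJ2, hhor, map_zero, neg_zero]
  obtain ⟨a, b, rfl⟩ := exists_horiz g he hz hA hlam hquot u
  obtain ⟨a', b', rfl⟩ := exists_horiz g he hz hA hlam hquot v
  simp only [map_add, LinearMap.add_apply, hhor, hJhor]
  rw [nijenhuisTensor_swap (horiz g e z a), hJhor, nijenhuisTensor_J hJ hJ2,
    nijenhuisTensor_swap (horiz g e z b), hJhor]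
  simp

omit hz in
include hmu' in
lemma isHermitianOn_natG_natJ (hc : HasConstantSectionalCurvature g c)
    (hmu : ∀ t > 0, 0 < lam t + 2 * t * mu t) :
    IsHermitianOn (inducedTarget e) (natG g A c lam mu e) (natJ g A c lam e) where
  smooth_J _ hz := (contDiffAt_natJ g he hz hA hlam hlam' hquot).contDiffWithinAt
  smooth_G _ hz := (contDiffAt_natG g he hz hA hlam' hmu' hquot).contDiffWithinAt
  sq_eq _ hz v := natJ_natJ g he hz hA hlam hquot v
  integrable X Y hX hY z hz := by
    have hD := (isOpen_inducedTarget he).mem_nhds hz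
    rw [nijenhuis_eq ((contDiffAt_natJ g he hz hA hlam hlam' hquot).differentiableAt (by simp))
      (natJ_natJ g he hz hA hlam hquot) ((hX.contDiffAt hD).differentiableAt (by simp))
      ((hY.contDiffAt hD).differentiableAt (by simp))]
    exact nijenhuisTensor_natJ g he hz hA hlam hlam' hquot hc _ _
  symm z _ u v := natG_symm g A c lam mu e z u v
  pos _ hz _ hv := natG_pos g he hz hA hlam hquot hmu hv
  compatible _ hz u v := natG_natJ_natJ g he hz hA hlam hquot u v

end

end Metric

/-! ### Change of charts -/

section Metric

lemma inducedTransition_snd {n : ℕ} {M : Type*} [TopologicalSpace M] (e e' : Chart n M)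
    (z : Phase n) : (inducedTransition e e' z).2 = z.2 ᵥ* jac e' e (e' (e.symm z.1)) := rfl

variable {n : ℕ} {M : Type*} [TopologicalSpace M] [ChartedSpace (EuclideanSpace ℝ (Fin n)) M]

section

variable {e e' : Chart n M} (he : e ∈ IsManifold.maximalAtlas (𝓡 n) ∞ M)
  (he' : e' ∈ IsManifold.maximalAtlas (𝓡 n) ∞ M) {q : EuclideanSpace ℝ (Fin n)}
  (hq : q ∈ e.target) (hq' : e.symm q ∈ e'.source)

include he he' hq hq'

lemma jac_mul_jac' : jac e e' q * jac e' e (e' (e.symm q)) = 1 :=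
  mul_eq_one_comm.1 (jac_mul_jac he he' hq hq')

lemma vecMul_jac_inducedTransition {z : Phase n} (hz : z.1 = q) :
    (inducedTransition e e' z).2 ᵥ* jac e e' q = z.2 := by
  subst hz
  rw [inducedTransition_snd, Matrix.vecMul_vecMul, jac_mul_jac he he' hq hq', Matrix.vecMul_one]

lemma contDiffAt_trans_apply (a : Fin n) : ContDiffAt ℝ ∞ (fun y => e' (e.symm y) a) q :=
  (EuclideanSpace.proj a : EuclideanSpace ℝ (Fin n) →L[ℝ] ℝ).contDiff.contDiffAt.comp q
    (contDiffAt_trans he he' hq hq')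

lemma contDiffAt_jac (a i : Fin n) : ContDiffAt ℝ ∞ (fun y => jac e e' y a i) q :=
  contDiffAt_pderiv (contDiffAt_trans_apply he he' hq hq' a) i

lemma pderiv_jac_symm (a i j : Fin n) :
    pderiv j (fun y => jac e e' y a i) q = pderiv i (fun y => jac e e' y a j) q :=
  pderiv_comm (contDiffAt_trans_apply he he' hq hq' a) j i

lemma mderiv_comp_trans {B : EuclideanSpace ℝ (Fin n) → Matrix (Fin n) (Fin n) ℝ}
    (hB : ∀ a b, DifferentiableAt ℝ (fun y => B y a b) (e' (e.symm q))) (j : Fin n) :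
    mderiv j (fun y => B (e' (e.symm y))) q =
      ∑ c, jac e e' q c j • mderiv c B (e' (e.symm q)) := by
  ext a b
  have hF := (contDiffAt_trans he he' hq hq').differentiableAt (by simp)
  have h := ((hB a b).hasFDerivAt.comp q hF.hasFDerivAt).fderiv
  refine (congrArg (fun L => L (stdVec j)) h).trans ?_
  rw [ContinuousLinearMap.comp_apply, fderiv_apply_eq_sum]
  simp [Matrix.sum_apply, mderiv, jac_eq_fderiv he he' hq hq']

end

section

variable {e e' : Chart n M} (he : e ∈ IsManifold.maximalAtlas (𝓡 n) ∞ M)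
  (he' : e' ∈ IsManifold.maximalAtlas (𝓡 n) ∞ M) {z : Phase n}
  (hz : z.1 ∈ e.target) (hz' : e.symm z.1 ∈ e'.source)

include he he' hz hz'

lemma differentiableAt_inducedTransition : DifferentiableAt ℝ (inducedTransition e e') z := by
  have hF := (contDiffAt_trans he he' hz hz').differentiableAt (by simp)
  have hq1 : e' (e.symm z.1) ∈ e'.target := e'.map_source hz'
  have hq2 : e'.symm (e' (e.symm z.1)) ∈ e.source := by
    rw [e'.left_inv hz']; exact e.map_target hz
  have hF' : DifferentiableAt ℝ (fun y : Phase n => e' (e.symm y.1)) z :=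
    DifferentiableAt.comp (g := fun y => e' (e.symm y)) z hF differentiableAt_fst
  unfold inducedTransition
  refine hF'.prodMk (differentiableAt_pi.2 fun i => DifferentiableAt.fun_sum fun k _ =>
    ((contDiffAt_snd_apply k z).differentiableAt (by simp)).mul ?_)
  exact DifferentiableAt.comp (f := fun y : Phase n => e' (e.symm y.1)) z
    ((contDiffAt_jac he' he hq1 hq2 k i).differentiableAt (by simp)) hF'

lemma fderiv_inducedTransition_fst (u : Phase n) :
    (fderiv ℝ (inducedTransition e e') z u).1.ofLp = jac e e' z.1 *ᵥ u.1.ofLp := by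
  have hΦ := (differentiableAt_inducedTransition he he' hz hz').hasFDerivAt
  have h1 := (hasFDerivAt_fst (𝕜 := ℝ)).comp z hΦ
  have hF := ((contDiffAt_trans he he' hz hz').differentiableAt (by simp)).hasFDerivAt
  have h2 := hF.comp z (hasFDerivAt_fst (𝕜 := ℝ))
  have h3 := congrArg (fun L => L u) (h1.unique h2)
  funext a
  have h4 : (fderiv ℝ (inducedTransition e e') z u).1 =
    fderiv ℝ (fun y => e' (e.symm y)) z.1 u.1 := h3
  rw [h4, fderiv_trans_apply he he' hz hz']
  rfl

/-- The derivative of `pᵢ = p'ₐ ∂q'ᵃ/∂qⁱ`. -/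
lemma snd_eq_fderiv_inducedTransition (u : Phase n) (i : Fin n) :
    u.2 i = ∑ a, ((fderiv ℝ (inducedTransition e e') z u).2 a * jac e e' z.1 a i
      + (inducedTransition e e' z).2 a *
        ∑ j, u.1 j * pderiv j (fun y => jac e e' y a i) z.1) := by
  have hΦ := (differentiableAt_inducedTransition he he' hz hz').hasFDerivAt
  have h1 : ∀ a, HasFDerivAt (fun y => (inducedTransition e e' y).2 a)
      ((dp a).comp (fderiv ℝ (inducedTransition e e') z)) z :=
    fun a => (dp (n := n) a).hasFDerivAt.comp z hΦ
  have h2 : ∀ a, HasFDerivAt (fun y : Phase n => jac e e' y.1 a i) _ z := fun a =>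
    ((contDiffAt_comp_fst (contDiffAt_jac he he' hz hz' a i)).differentiableAt
      (by simp)).hasFDerivAt
  have h3 := HasFDerivAt.fun_sum (u := Finset.univ) fun a _ => (h1 a).mul (h2 a)
  have h4 : (fun y : Phase n => y.2 i) =ᶠ[nhds z]
      fun y => ∑ a, (inducedTransition e e' y).2 a * jac e e' y.1 a i := by
    have : (Prod.fst ⁻¹' (e.symm.trans e').source : Set (Phase n)) ∈ nhds z :=
      ((e.symm.trans e').open_source.preimage continuous_fst).mem_nhds ⟨hz, hz'⟩
    filter_upwards [this] with y hy
    exact (congrFun (vecMul_jac_inducedTransition he he' hy.1 hy.2 rfl) i).symm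
  rw [← fderiv_snd_apply i z u, h4.fderiv_eq]
  refine (congrArg (fun L => L u) h3.fderiv).trans ?_
  simp only [smul_apply, sum_apply, _root_.add_apply, smul_eq_mul,
    fderiv_comp_fst (contDiffAt_jac he he' hz hz' _ _), ContinuousLinearMap.comp_apply, dp_apply]
  exact Finset.sum_congr rfl fun k _ => by ring

end

variable [IsManifold (𝓡 n) ∞ M] (g : Metric n M)

section

variable {e e' : Chart n M} (he : e ∈ IsManifold.maximalAtlas (𝓡 n) ∞ M)
  (he' : e' ∈ IsManifold.maximalAtlas (𝓡 n) ∞ M) {q : EuclideanSpace ℝ (Fin n)}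
  (hq : q ∈ e.target) (hq' : e.symm q ∈ e'.source)

include he he' hq hq'

/-- The transformation law of the Christoffel symbols. Its right-hand side is torsion free and
makes the metric parallel. -/
lemma jac_mul_connMatrix (j : Fin n) : jac e e' q * connMatrix g e j q =
    mderiv j (jac e e') q +
      (∑ c, jac e e' q c j • connMatrix g e' c (e' (e.symm q))) * jac e e' q := by
  have hq1 : e' (e.symm q) ∈ e'.target := e'.map_source hq'
  set P := jac e e' q with hP
  set K := jac e' e (e' (e.symm q)) with hK
  have hKP : K * P = 1 := jac_mul_jac he he' hq hq'
  have hPK : P * K = 1 := jac_mul_jac' he he' hq hq'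
  set Γ' : Fin n → Matrix (Fin n) (Fin n) ℝ :=
    fun j => ∑ c, P c j • connMatrix g e' c (e' (e.symm q)) with hΓ'
  have dP : ∀ a b, DifferentiableAt ℝ (fun y => jac e e' y a b) q := fun a b =>
    (contDiffAt_jac he he' hq hq' a b).differentiableAt (by simp)
  have dPt : ∀ a b, DifferentiableAt ℝ (fun y => (jac e e' y)ᵀ a b) q := fun a b => dP b a
  have dg : ∀ a b, DifferentiableAt ℝ (fun y => gLow g e' (e' (e.symm y)) a b) q := fun a b =>
    DifferentiableAt.comp (g := fun y => gLow g e' y a b) (f := fun y => e' (e.symm y)) q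
      ((contDiffAt_gLow g he' hq1 a b).differentiableAt (by simp))
      ((contDiffAt_trans he he' hq hq').differentiableAt (by simp))
  have dPg : ∀ a b, DifferentiableAt ℝ
      (fun y => ((jac e e' y)ᵀ * gLow g e' (e' (e.symm y))) a b) q := by
    intro a b
    simp only [Matrix.mul_apply]
    exact DifferentiableAt.fun_sum fun m _ => (dPt a m).mul (dg m b)
  -- the candidate for the connection matrices in the chart `e`
  set C : Fin n → Matrix (Fin n) (Fin n) ℝ :=
    fun j => K * (mderiv j (jac e e') q + Γ' j * P) with hC
  have hsymm : ∀ k i j, C i k j = C j k i := by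
    intro k i j
    have h : ∀ a, (mderiv i (jac e e') q + Γ' i * P) a j =
        (mderiv j (jac e e') q + Γ' j * P) a i := by
      intro a
      have h1 : mderiv i (jac e e') q a j = mderiv j (jac e e') q a i :=
        pderiv_jac_symm he he' hq hq' a j i
      have h2 : (Γ' i * P) a j = (Γ' j * P) a i := by
        simp only [hΓ', Matrix.mul_apply, Matrix.sum_apply, Matrix.smul_apply, smul_eq_mul,
          Finset.sum_mul, connMatrix, Matrix.of_apply]
        rw [Finset.sum_comm]
        refine Finset.sum_congr rfl fun c _ => Finset.sum_congr rfl fun b _ => ?_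
        rw [christoffel_symm g e' a c b]
        ring
      rw [Matrix.add_apply, Matrix.add_apply, h1, h2]
    simp only [hC, Matrix.mul_apply (M := K), h]
  have hpar : ∀ j, mderiv j (gLow g e) q = gLow g e q * C j + (C j)ᵀ * gLow g e q := by
    intro j
    have hev : gLow g e =ᶠ[nhds q]
        fun y => (jac e e' y)ᵀ * gLow g e' (e' (e.symm y)) * jac e e' y := by
      filter_upwards [(e.symm.trans e').open_source.mem_nhds ⟨hq, hq'⟩] with y hy
      exact gLow_eq g he he' hy.1 hy.2
    have hΓg : ∑ c, P c j • (gLow g e' (e' (e.symm q)) * connMatrix g e' c (e' (e.symm q))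
        + (connMatrix g e' c (e' (e.symm q)))ᵀ * gLow g e' (e' (e.symm q))) =
        gLow g e' (e' (e.symm q)) * Γ' j + (Γ' j)ᵀ * gLow g e' (e' (e.symm q)) := by
      simp only [hΓ', Finset.mul_sum, Finset.sum_mul, Matrix.transpose_sum, Matrix.transpose_smul,
        smul_add, Finset.sum_add_distrib, smul_mul_assoc, mul_smul_comm]
    rw [mderiv_congr j hev, mderiv_mul j dPg dP, mderiv_mul j dPt dg, mderiv_transpose,
      mderiv_comp_trans he he' hq hq'
        (fun a b => (contDiffAt_gLow g he' hq1 a b).differentiableAt (by simp)),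
      gLow_eq g he he' hq hq']
    simp only [mderiv_gLow g he' hq1]
    rw [← hP, hΓg]
    simp only [hC, Matrix.transpose_mul, Matrix.transpose_add]
    have h1 : Pᵀ * gLow g e' (e' (e.symm q)) * P * (K * (mderiv j (jac e e') q + Γ' j * P)) =
        Pᵀ * gLow g e' (e' (e.symm q)) * (mderiv j (jac e e') q + Γ' j * P) := by
      rw [← mul_assoc, mul_assoc _ P K, hPK, mul_one]
    have h2 : ((mderiv j (jac e e') q)ᵀ + Pᵀ * (Γ' j)ᵀ) * Kᵀ *
        (Pᵀ * gLow g e' (e' (e.symm q)) * P) =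
        ((mderiv j (jac e e') q)ᵀ + Pᵀ * (Γ' j)ᵀ) * gLow g e' (e' (e.symm q)) * P := by
      have : Kᵀ * Pᵀ = 1 := by rw [← Matrix.transpose_mul, hPK, Matrix.transpose_one]
      calc _ = ((mderiv j (jac e e') q)ᵀ + Pᵀ * (Γ' j)ᵀ) * (Kᵀ * Pᵀ) *
            gLow g e' (e' (e.symm q)) * P := by noncomm_ring
        _ = _ := by rw [this, mul_one]
    rw [h1, h2]
    noncomm_ring
  have hCΓ : C j = connMatrix g e j q := by
    ext k l
    refine christoffel_unique g he hq (C := fun k i j => C i k j) (fun k i j => hsymm k i j)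
      (fun j k l => ?_) k j l
    have h := congrFun (congrFun (hpar j) k) l
    simp only [Matrix.add_apply, Matrix.mul_apply (M := gLow g e q), Matrix.transpose_apply,
      Matrix.mul_apply (M := (C j)ᵀ)] at h
    rw [Finset.sum_add_distrib]
    refine h.trans (congrArg₂ (· + ·) rfl (Finset.sum_congr rfl fun m _ => ?_))
    rw [gLow_symm g e q l m, mul_comm]
  rw [← hCΓ, hC, ← mul_assoc, hPK, one_mul]

lemma gUp_eq : gUp g e' (e' (e.symm q)) = jac e e' q * gUp g e q * (jac e e' q)ᵀ := by
  have hq1 : e' (e.symm q) ∈ e'.target := e'.map_source hq'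
  have hKP := jac_mul_jac he he' hq hq'
  have hPK := jac_mul_jac' he he' hq hq'
  have hg := gLow_eq g he he' hq hq'
  have h1 := gLow_mul_gUp g he hq
  have h2 := gUp_mul_gLow g he' hq1
  generalize jac e e' q = P at *
  generalize jac e' e (e' (e.symm q)) = K at *
  have hPKt : Kᵀ * Pᵀ = 1 := by rw [← Matrix.transpose_mul, hPK, Matrix.transpose_one]
  have h3 : gLow g e' (e' (e.symm q)) * (P * gUp g e q * Pᵀ) = 1 := by
    calc gLow g e' (e' (e.symm q)) * (P * gUp g e q * Pᵀ)
        = (Kᵀ * Pᵀ) * gLow g e' (e' (e.symm q)) * (P * gUp g e q * Pᵀ) := by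
          rw [hPKt, one_mul]
      _ = Kᵀ * ((Pᵀ * gLow g e' (e' (e.symm q)) * P) * gUp g e q) * Pᵀ := by noncomm_ring
      _ = 1 := by rw [← hg, h1, mul_one, hPKt]
  calc gUp g e' (e' (e.symm q))
      = gUp g e' (e' (e.symm q)) * (gLow g e' (e' (e.symm q)) * (P * gUp g e q * Pᵀ)) := by
        rw [h3, mul_one]
    _ = P * gUp g e q * Pᵀ := by rw [← mul_assoc, h2, one_mul]

end

section

variable {e e' : Chart n M} (he : e ∈ IsManifold.maximalAtlas (𝓡 n) ∞ M)
  (he' : e' ∈ IsManifold.maximalAtlas (𝓡 n) ∞ M) {z : Phase n}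
  (hz : z.1 ∈ e.target) (hz' : e.symm z.1 ∈ e'.source)

include he he' hz hz'

lemma gZero_inducedTransition :
    gZero g e' (inducedTransition e e' z) = jac e e' z.1 *ᵥ gZero g e z := by
  have h := vecMul_jac_inducedTransition he he' hz hz' rfl
  have h1 : gUp g e' (inducedTransition e e' z).1 = _ := gUp_eq g he he' hz hz'
  rw [gZero_eq, gZero_eq, h1, ← Matrix.mulVec_mulVec, ← Matrix.mulVec_mulVec,
    Matrix.mulVec_transpose, h]

lemma energy_inducedTransition :
    energy g e' (inducedTransition e e' z) = energy g e z := by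
  have h := vecMul_jac_inducedTransition he he' hz hz' rfl
  have h1 := dotProduct_gZero g e' (inducedTransition e e' z)
  rw [gZero_inducedTransition g he he' hz hz', Matrix.dotProduct_mulVec, h, dotProduct_gZero] at h1
  linarith

lemma lowMat_inducedTransition (a b : ℝ) : lowMat g e z a b =
    (jac e e' z.1)ᵀ * lowMat g e' (inducedTransition e e' z) a b * jac e e' z.1 := by
  have h := vecMul_jac_inducedTransition he he' hz hz' rfl
  have h1 : gLow g e z.1 = (jac e e' z.1)ᵀ * gLow g e' (inducedTransition e e' z).1 *
    jac e e' z.1 := gLow_eq g he he' hz hz'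
  rw [lowMat, lowMat, h1]
  simp only [mul_add, add_mul, mul_smul_comm, smul_mul_assoc, Matrix.mul_vecMulVec,
    Matrix.vecMulVec_mul, Matrix.mulVec_transpose, h]

lemma upMat_inducedTransition (a b : ℝ) : upMat g e' (inducedTransition e e' z) a b =
    jac e e' z.1 * upMat g e z a b * (jac e e' z.1)ᵀ := by
  have h1 : gUp g e' (inducedTransition e e' z).1 = _ := gUp_eq g he he' hz hz'
  rw [upMat, upMat, h1, gZero_inducedTransition g he he' hz hz']
  simp only [mul_add, add_mul, mul_smul_comm, smul_mul_assoc, Matrix.mul_vecMulVec,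
    Matrix.vecMulVec_mul, Matrix.vecMul_transpose]

/-- `Dpᵢ = ∂q'ᵃ/∂qⁱ Dp'ₐ`. -/
lemma vertPart_inducedTransition (u : Phase n) : vertPart g e z u =
    vertPart g e' (inducedTransition e e' z) (fderiv ℝ (inducedTransition e e') z u)
      ᵥ* jac e e' z.1 := by
  have h := vecMul_jac_inducedTransition he he' hz hz' rfl
  have hu := fderiv_inducedTransition_fst he he' hz hz' u
  funext i
  have hΓ : ∀ j, christoffelZero g e z i j =
      ∑ a, (inducedTransition e e' z).2 a * pderiv j (fun y => jac e e' y a i) z.1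
        + ∑ b, (∑ d, christoffelZero g e' (inducedTransition e e' z) b d * jac e e' z.1 d j)
          * jac e e' z.1 b i := by
    intro j
    have h1 : christoffelZero g e z i j =
        ((inducedTransition e e' z).2 ᵥ* (jac e e' z.1 * connMatrix g e j z.1)) i := by
      rw [← Matrix.vecMul_vecMul, h, christoffelZero_symm]
      rfl
    rw [h1, jac_mul_connMatrix g he he' hz hz', Matrix.vecMul_add, Pi.add_apply,
      ← Matrix.vecMul_vecMul]
    congr 1
    simp only [Matrix.vecMul, dotProduct]
    refine Finset.sum_congr rfl fun b _ => ?_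
    congr 1
    simp only [Matrix.sum_apply, Matrix.smul_apply, smul_eq_mul, connMatrix, Matrix.of_apply,
      christoffelZero, Finset.mul_sum, Finset.sum_mul]
    rw [Finset.sum_comm]
    refine Finset.sum_congr rfl fun d _ => Finset.sum_congr rfl fun a _ => ?_
    rw [christoffel_symm g e' a b d]
    change _ = _ * christoffel g e' a d b (e' (e.symm z.1)) * _
    ring
  have hL : vertPart g e z u i = covDp g e z i u := rfl
  rw [hL, covDp_apply, snd_eq_fderiv_inducedTransition he he' hz hz' u i]
  simp only [hΓ, Matrix.vecMul, dotProduct, vertPart, covDp_apply, hu, Matrix.mulVec,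
    Finset.sum_add_distrib, add_mul, sub_mul, Finset.sum_sub_distrib]
  have e1 : ∑ a, (inducedTransition e e' z).2 a *
      ∑ j, u.1 j * pderiv j (fun y => jac e e' y a i) z.1 =
      ∑ j, (∑ a, (inducedTransition e e' z).2 a * pderiv j (fun y => jac e e' y a i) z.1) *
        u.1 j := by
    simp only [Finset.mul_sum, Finset.sum_mul]
    rw [Finset.sum_comm]
    exact Finset.sum_congr rfl fun j _ => Finset.sum_congr rfl fun a _ => by ring
  have e2 : ∑ b, (∑ d, christoffelZero g e' (inducedTransition e e' z) b d *
        ∑ j, jac e e' z.1 d j * u.1 j) * jac e e' z.1 b i =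
      ∑ j, (∑ b, (∑ d, christoffelZero g e' (inducedTransition e e' z) b d * jac e e' z.1 d j)
          * jac e e' z.1 b i) * u.1 j := by
    have h1 : ∀ b, ∑ d, christoffelZero g e' (inducedTransition e e' z) b d *
        ∑ j, jac e e' z.1 d j * u.1 j =
        ∑ j, (∑ d, christoffelZero g e' (inducedTransition e e' z) b d * jac e e' z.1 d j)
          * u.1 j := by
      intro b
      simp only [Finset.mul_sum, Finset.sum_mul]
      rw [Finset.sum_comm]
      exact Finset.sum_congr rfl fun j _ => Finset.sum_congr rfl fun a _ => by ring
    have h2 : ∀ X : Fin n → Fin n → ℝ, ∑ b, (∑ j, X b j * u.1 j) * jac e e' z.1 b i =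
        ∑ j, (∑ b, X b j * jac e e' z.1 b i) * u.1 j := by
      intro X
      simp only [Finset.sum_mul]
      rw [Finset.sum_comm]
      exact Finset.sum_congr rfl fun j _ => Finset.sum_congr rfl fun a _ => by ring
    simp only [h1]
    exact h2 _
  rw [e1, e2]
  ring

variable (A c : ℝ) (lam mu : ℝ → ℝ)

lemma natG_inducedTransition (u v : Phase n) :
    natG g A c lam mu e' (inducedTransition e e' z) (fderiv ℝ (inducedTransition e e') z u)
      (fderiv ℝ (inducedTransition e e') z v) = natG g A c lam mu e z u v := by
  have h1 : matG1 g A c lam mu e z = (jac e e' z.1)ᵀ *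
      matG1 g A c lam mu e' (inducedTransition e e' z) * jac e e' z.1 := by
    rw [matG1, matG1, energy_inducedTransition g he he' hz hz',
      ← lowMat_inducedTransition g he he' hz hz']
  have h2 : matG2 g A c lam mu e' (inducedTransition e e' z) = jac e e' z.1 *
      matG2 g A c lam mu e z * (jac e e' z.1)ᵀ := by
    rw [matG2, matG2, energy_inducedTransition g he he' hz hz',
      ← upMat_inducedTransition g he he' hz hz']
  rw [natG_apply, natG_apply, h1, h2, fderiv_inducedTransition_fst he he' hz hz',
    fderiv_inducedTransition_fst he he' hz hz', vertPart_inducedTransition g he he' hz hz' u,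
    vertPart_inducedTransition g he he' hz hz' v]
  congr 1
  · rw [← Matrix.mulVec_mulVec, ← Matrix.mulVec_mulVec, Matrix.dotProduct_mulVec u.1.ofLp,
      Matrix.vecMul_transpose]
  · rw [← Matrix.mulVec_mulVec, ← Matrix.mulVec_mulVec, Matrix.dotProduct_mulVec,
      Matrix.mulVec_transpose]

lemma natJ_inducedTransition (v : Phase n) :
    natJ g A c lam e' (inducedTransition e e' z) (fderiv ℝ (inducedTransition e e') z v) =
      fderiv ℝ (inducedTransition e e') z (natJ g A c lam e z v) := by
  have h1 : matJ1 g A c lam e z = (jac e e' z.1)ᵀ *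
      matJ1 g A c lam e' (inducedTransition e e' z) * jac e e' z.1 := by
    rw [matJ1, matJ1, energy_inducedTransition g he he' hz hz',
      ← lowMat_inducedTransition g he he' hz hz']
  have h2 : matJ2 g A c lam e' (inducedTransition e e' z) = jac e e' z.1 *
      matJ2 g A c lam e z * (jac e e' z.1)ᵀ := by
    rw [matJ2, matJ2, energy_inducedTransition g he he' hz hz',
      ← upMat_inducedTransition g he he' hz hz']
  refine phase_ext (g := g) (e := e') (z := inducedTransition e e' z) (congrFun ?_) (congrFun ?_)
  · rw [natJ_fst, fderiv_inducedTransition_fst he he' hz hz', natJ_fst, h2, Matrix.mulVec_neg,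
      vertPart_inducedTransition g he he' hz hz' v, ← Matrix.mulVec_mulVec, ← Matrix.mulVec_mulVec,
      Matrix.mulVec_transpose]
  · have h3 := vertPart_natJ g A c lam e' (inducedTransition e e' z)
      (fderiv ℝ (inducedTransition e e') z v)
    have h4 := vertPart_inducedTransition g he he' hz hz' (natJ g A c lam e z v)
    rw [vertPart_natJ, h1, ← Matrix.mulVec_mulVec, ← Matrix.mulVec_mulVec,
      Matrix.mulVec_transpose, ← fderiv_inducedTransition_fst he he' hz hz', ← h3] at h4
    have h5 := congrArg (fun w => w ᵥ* jac e' e (e' (e.symm z.1))) h4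
    simp only [Matrix.vecMul_vecMul, jac_mul_jac' he he' hz hz', Matrix.vecMul_one] at h5
    exact h5

end

end Metric

/-! ### The fundamental form and its exterior derivative -/

section Wedge

variable {V : Type*} [NormedAddCommGroup V] [NormedSpace ℝ V]

/-- The exterior product of two `1`-forms, `(α ∧ β)(u, v) = α(u) β(v) - α(v) β(u)`. -/
def wedge (α β : V →L[ℝ] ℝ) : V [⋀^Fin 2]→L[ℝ] ℝ :=
  ContinuousAlternatingMap.alternatizeUncurryFin
    (α.smulRight (ContinuousAlternatingMap.ofSubsingletonLIE (𝕜 := ℝ) (E := V) (F := ℝ) (0 : Fin 1) β))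

lemma wedge_apply (α β : V →L[ℝ] ℝ) (u v : V) :
    wedge α β ![u, v] = α u * β v - α v * β u := by
  rw [wedge, ContinuousAlternatingMap.alternatizeUncurryFin_apply, Fin.sum_univ_two]
  simp [Fin.removeNth, sub_eq_add_neg]

lemma contDiff_alternatizeUncurryFin {𝕜 E F : Type*} [NontriviallyNormedField 𝕜]
    [NormedAddCommGroup E] [NormedSpace 𝕜 E] [NormedAddCommGroup F] [NormedSpace 𝕜 F]
    (n : ℕ) {m : WithTop ℕ∞} : ContDiff 𝕜 m fun f : E →L[𝕜] E [⋀^Fin n]→L[𝕜] F =>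
      ContinuousAlternatingMap.alternatizeUncurryFin f :=
  IsBoundedLinearMap.contDiff
    ⟨⟨fun a b => ContinuousAlternatingMap.alternatizeUncurryFin_add a b,
      fun c a => ContinuousAlternatingMap.alternatizeUncurryFin_smul c a⟩,
      (n + 1 : ℝ) + 1, by positivity, fun f => by
        have := ContinuousAlternatingMap.norm_alternatizeUncurryFin_le f
        nlinarith [norm_nonneg f]⟩

lemma contDiffAt_wedge {α β : V → V →L[ℝ] ℝ} {z : V} (hα : ContDiffAt ℝ ∞ α z)
    (hβ : ContDiffAt ℝ ∞ β z) : ContDiffAt ℝ ∞ (fun y => wedge (α y) (β y)) z :=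
  (contDiff_alternatizeUncurryFin 1).contDiffAt.comp z
    (hα.smulRight ((ContinuousAlternatingMap.ofSubsingletonLIE
      (𝕜 := ℝ) (E := V) (F := ℝ) (0 : Fin 1)).contDiff.contDiffAt.comp z hβ))

lemma ext_two {φ ψ : V [⋀^Fin 2]→L[ℝ] ℝ} (h : ∀ u v, φ ![u, v] = ψ ![u, v]) : φ = ψ := by
  ext v
  have : v = ![v 0, v 1] := by
    ext i; fin_cases i <;> rfl
  rw [this, h]

lemma extDeriv_two_apply {φ : V → V [⋀^Fin 2]→L[ℝ] ℝ} {z : V} (h : DifferentiableAt ℝ φ z)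
    (u v w : V) : extDeriv φ z ![u, v, w] = fderiv ℝ (fun y => φ y ![v, w]) z u
      - fderiv ℝ (fun y => φ y ![u, w]) z v + fderiv ℝ (fun y => φ y ![u, v]) z w := by
  have h0 : (0 : Fin 3).removeNth ![u, v, w] = ![v, w] := by
    ext i; fin_cases i <;> rfl
  have h1 : (1 : Fin 3).removeNth ![u, v, w] = ![u, w] := by
    ext i; fin_cases i <;> rfl
  have h2 : (2 : Fin 3).removeNth ![u, v, w] = ![u, v] := by
    ext i; fin_cases i <;> rfl
  rw [extDeriv_apply h, Fin.sum_univ_three, h0, h1, h2]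
  simp [sub_eq_add_neg]

end Wedge

section Metric

variable {n : ℕ} {M : Type*} [TopologicalSpace M] [ChartedSpace (EuclideanSpace ℝ (Fin n)) M]
  [IsManifold (𝓡 n) ∞ M] (g : Metric n M)

/-- The `2`-form `λ(t) dpᵢ ∧ dqⁱ + μ(t) dt ∧ pᵢ dqⁱ`. -/
def fundamentalForm (lam mu : ℝ → ℝ) (e : Chart n M) (z : Phase n) :
    Phase n [⋀^Fin 2]→L[ℝ] ℝ :=
  lam (energy g e z) • ∑ i, wedge (dp i) (dq i)
    + mu (energy g e z) • wedge (fderiv ℝ (energy g e) z) (∑ i, z.2 i • dq i)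

/-- The value of `dpᵢ ∧ dqⁱ` on two vectors. -/
def canonicalForm (u v : Phase n) : ℝ := u.2 ⬝ᵥ v.1.ofLp - v.2 ⬝ᵥ u.1.ofLp

lemma fundamentalForm_apply (lam mu : ℝ → ℝ) (e : Chart n M) (z u v : Phase n) :
    fundamentalForm g lam mu e z ![u, v] = lam (energy g e z) * canonicalForm u v
      + mu (energy g e z) * (fderiv ℝ (energy g e) z u * (z.2 ⬝ᵥ v.1.ofLp)
        - fderiv ℝ (energy g e) z v * (z.2 ⬝ᵥ u.1.ofLp)) := by
  simp [fundamentalForm, wedge_apply, canonicalForm, dotProduct, dq_apply, dp_apply,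
    ContinuousAlternatingMap.sum_apply, Finset.sum_sub_distrib]

/-- `dpᵢ ∧ dqⁱ = Dpᵢ ∧ dqⁱ`, since the connection is torsion free. -/
lemma canonicalForm_eq (e : Chart n M) (z u v : Phase n) : canonicalForm u v =
    vertPart g e z u ⬝ᵥ v.1.ofLp - vertPart g e z v ⬝ᵥ u.1.ofLp := by
  have h : ∑ i, (∑ j, christoffelZero g e z i j * u.1 j) * v.1 i =
      ∑ i, (∑ j, christoffelZero g e z i j * v.1 j) * u.1 i := by
    simp only [Finset.sum_mul]
    rw [Finset.sum_comm]
    exact Finset.sum_congr rfl fun i _ => Finset.sum_congr rfl fun j _ => by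
      rw [christoffelZero_symm]; ring
  simp only [canonicalForm, vertPart, dotProduct, covDp_apply, sub_mul, Finset.sum_sub_distrib, h]
  ring

section

variable {lam mu : ℝ → ℝ} {e : Chart n M} (he : e ∈ IsManifold.maximalAtlas (𝓡 n) ∞ M)
  {z : Phase n} (hz : z ∈ inducedTarget e)
  (hlam' : ContDiffOn ℝ ∞ lam (Set.Ioi 0)) (hmu' : ContDiffOn ℝ ∞ mu (Set.Ioi 0))

include he hz

/-- `g^{0h} Dp_h ∧ Dpᵢ ∧ dqⁱ = dt ∧ dpᵢ ∧ dqⁱ`. -/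
lemma threeForm_eq (u v w : Phase n) : threeForm g e z u v w =
    fderiv ℝ (energy g e) z u * canonicalForm v w - fderiv ℝ (energy g e) z v * canonicalForm u w
      + fderiv ℝ (energy g e) z w * canonicalForm u v := by
  simp only [canonicalForm_eq g e z, fderiv_energy g he hz.1, threeForm, Matrix.det_fin_three,
    dotProduct, vertPart, ← Finset.sum_sub_distrib, Finset.sum_mul_sum, ← Finset.sum_add_distrib]
  refine Finset.sum_congr rfl fun h _ => Finset.sum_congr rfl fun i _ => ?_
  simp [dq_apply]
  ring

include hlam' hmu'

lemma contDiffAt_fundamentalForm : ContDiffAt ℝ ∞ (fundamentalForm g lam mu e) z := by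
  unfold fundamentalForm
  refine ((contDiffAt_comp_energy g he hz hlam').smul contDiffAt_const).add
    ((contDiffAt_comp_energy g he hz hmu').smul (contDiffAt_wedge
      ((contDiffAt_energy g he hz.1).fderiv_right (by simp)) ?_))
  exact ContDiffAt.sum fun i _ => (contDiffAt_snd_apply i z).smul contDiffAt_const

lemma fderiv_fundamentalForm (u v w : Phase n) :
    fderiv ℝ (fun y => fundamentalForm g lam mu e y ![v, w]) z u =
      deriv lam (energy g e z) * fderiv ℝ (energy g e) z u * canonicalForm v w
      + deriv mu (energy g e z) * fderiv ℝ (energy g e) z u *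
        (fderiv ℝ (energy g e) z v * (z.2 ⬝ᵥ w.1.ofLp)
          - fderiv ℝ (energy g e) z w * (z.2 ⬝ᵥ v.1.ofLp))
      + mu (energy g e z) *
        (fderiv ℝ (fderiv ℝ (energy g e)) z u v * (z.2 ⬝ᵥ w.1.ofLp)
          + fderiv ℝ (energy g e) z v * (u.2 ⬝ᵥ w.1.ofLp)
          - fderiv ℝ (fderiv ℝ (energy g e)) z u w * (z.2 ⬝ᵥ v.1.ofLp)
          - fderiv ℝ (energy g e) z w * (u.2 ⬝ᵥ v.1.ofLp)) := by
  have hE := ((contDiffAt_energy g he hz.1).differentiableAt (by simp)).hasFDerivAt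
  have hcomp : ∀ {f : ℝ → ℝ}, ContDiffOn ℝ ∞ f (Set.Ioi 0) →
      HasFDerivAt (fun y => f (energy g e y))
        (deriv f (energy g e z) • fderiv ℝ (energy g e) z) z := by
    intro f hf
    have := ((hf.contDiffAt (Ioi_mem_nhds (energy_pos g he hz))).differentiableAt
      (by simp)).hasDerivAt
    exact this.comp_hasFDerivAt z hE
  have hdE : DifferentiableAt ℝ (fderiv ℝ (energy g e)) z :=
    ((contDiffAt_energy g he hz.1).fderiv_right (m := ∞) (by simp)).differentiableAt (by simp)
  have hd : ∀ v, HasFDerivAt (fun y => fderiv ℝ (energy g e) y v)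
      ((fderiv ℝ (fderiv ℝ (energy g e)) z).flip v) z := by
    intro v
    have := hdE.hasFDerivAt.clm_apply (hasFDerivAt_const v z)
    simpa using this
  have hθ : ∀ v : Phase n, HasFDerivAt (fun y : Phase n => y.2 ⬝ᵥ v.1.ofLp)
      (∑ i, v.1 i • dp i) z := by
    intro v
    have h := (∑ i, v.1 i • dp i : Phase n →L[ℝ] ℝ).hasFDerivAt (x := z)
    refine h.congr_of_eventuallyEq (Filter.Eventually.of_forall fun y => ?_)
    simp [dotProduct, dp_apply, mul_comm]
  have h := ((hcomp hlam').mul_const (canonicalForm v w)).add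
    ((hcomp hmu').mul (((hd v).mul (hθ w)).sub ((hd w).mul (hθ v))))
  simp only [fundamentalForm_apply]
  refine (congrArg (fun L => L u) h.fderiv).trans ?_
  have hdp : ∀ v : Phase n, (∑ i, v.1 i • dp i : Phase n →L[ℝ] ℝ) u = u.2 ⬝ᵥ v.1.ofLp := by
    intro v
    simp [dotProduct, dp_apply, mul_comm]
  simp only [_root_.add_apply, _root_.sub_apply, smul_apply, smul_eq_mul, hdp,
    ContinuousLinearMap.flip_apply, Pi.mul_apply, Pi.sub_apply]
  ring

/-- `dφ = (λ' - μ) dt ∧ dpᵢ ∧ dqⁱ`. -/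
lemma extDeriv_fundamentalForm (u v w : Phase n) :
    extDeriv (fundamentalForm g lam mu e) z ![u, v, w] =
      (deriv lam (energy g e z) - mu (energy g e z)) * threeForm g e z u v w := by
  have hsymm : ∀ u v, fderiv ℝ (fderiv ℝ (energy g e)) z u v =
      fderiv ℝ (fderiv ℝ (energy g e)) z v u := fun u v =>
    ((contDiffAt_energy g he hz.1).isSymmSndFDerivAt (by
      rw [minSmoothness_of_isRCLikeNormedField]
      exact WithTop.coe_le_coe.2 (le_top : (2 : ℕ∞) ≤ ⊤))).eq u v
  rw [extDeriv_two_apply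
    ((contDiffAt_fundamentalForm g he hz hlam' hmu').differentiableAt (by simp)),
    fderiv_fundamentalForm g he hz hlam' hmu', fderiv_fundamentalForm g he hz hlam' hmu',
    fderiv_fundamentalForm g he hz hlam' hmu', threeForm_eq g he hz, hsymm v u, hsymm w u,
    hsymm w v]
  simp only [canonicalForm]
  ring

end

lemma isFundamentalForm_fundamentalForm {A c : ℝ} {lam mu : ℝ → ℝ} {e : Chart n M}
    (he : e ∈ IsManifold.maximalAtlas (𝓡 n) ∞ M) (hA : 0 < A) (hlam : ∀ t > 0, 0 < lam t)
    (hlam' : ContDiffOn ℝ ∞ lam (Set.Ioi 0)) (hmu' : ContDiffOn ℝ ∞ mu (Set.Ioi 0))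
    (hquot : ∀ t > 0, 0 < (2 * c - A ^ 2 * t * lam t ^ 2) / (lam t + 2 * t * deriv lam t)) :
    IsFundamentalForm (inducedTarget e) (natG g A c lam mu e) (natJ g A c lam e)
      (fundamentalForm g lam mu e) := by
  refine ⟨fun z hz => (contDiffAt_fundamentalForm g he hz hlam' hmu').contDiffWithinAt,
    fun z hz u v => ?_⟩
  rw [fundamentalForm_apply, natG_natJ g he hz hA hlam hquot, canonicalForm_eq g e z,
    fderiv_energy g he hz.1, fderiv_energy g he hz.1]
  rfl

/-- In dimension at least `2`, the form `g^{0h} Dp_h ∧ Dpᵢ ∧ dqⁱ` vanishes nowhere. -/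
lemma exists_threeForm_ne_zero (hn : 2 ≤ n) {e : Chart n M}
    (he : e ∈ IsManifold.maximalAtlas (𝓡 n) ∞ M) {z : Phase n} (hz : z ∈ inducedTarget e) :
    ∃ u v w, threeForm g e z u v w ≠ 0 := by
  obtain ⟨β, hβ0, hβ⟩ : ∃ β : Fin n → ℝ, β ≠ 0 ∧ gZero g e z ⬝ᵥ β = 0 := by
    let i : Fin n := ⟨0, by omega⟩
    let j : Fin n := ⟨1, by omega⟩
    have hij : i ≠ j := by simp [i, j]
    by_cases h : gZero g e z j = 0
    · exact ⟨Pi.single j 1, by simp, by simp [h]⟩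
    · refine ⟨Pi.single i (gZero g e z j) - Pi.single j (gZero g e z i), fun h0 => h ?_, ?_⟩
      · have := congrFun h0 i
        simpa [hij] using this
      · rw [dotProduct_sub, dotProduct_single, dotProduct_single]
        ring
  have hcov : ∀ (α : Fin n → ℝ), fderiv ℝ (energy g e) z (0, α) = gZero g e z ⬝ᵥ α := by
    intro α
    simp [fderiv_energy g he hz.1, covDp_apply, dotProduct]
  have hw : fderiv ℝ (energy g e) z (horiz g e z β) = 0 := by
    rw [fderiv_energy g he hz.1]
    exact Finset.sum_eq_zero fun h _ => by
      rw [show covDp g e z h (horiz g e z β) = 0 from congrFun (vertPart_horiz g e z β) h, mul_zero]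
  refine ⟨(0, z.2), (0, β), horiz g e z β, ?_⟩
  rw [threeForm_eq g he hz, hcov, hcov, hβ, hw, dotProduct_comm, dotProduct_gZero]
  have h1 : canonicalForm (0, β) (horiz g e z β) = β ⬝ᵥ β := by
    simp [canonicalForm, horiz_fst]
  rw [h1, zero_mul, zero_mul, sub_zero, add_zero]
  have h2 : 0 < energy g e z := energy_pos g he hz
  exact mul_ne_zero (by positivity) (dotProduct_self_eq_zero.not.2 hβ0)

/-- The energy density takes every positive value. -/
lemma exists_energy_eq [Nonempty M] (hn : 2 ≤ n) {t : ℝ} (ht : 0 < t) :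
    ∃ e ∈ IsManifold.maximalAtlas (𝓡 n) ∞ M, ∃ z ∈ inducedTarget e, energy g e z = t := by
  obtain ⟨x⟩ := ‹Nonempty M›
  let e : Chart n M := chartAt (EuclideanSpace ℝ (Fin n)) x
  have he : e ∈ IsManifold.maximalAtlas (𝓡 n) ∞ M := IsManifold.chart_mem_maximalAtlas x
  have hq : e x ∈ e.target := mem_chart_target _ x
  let p : Fin n → ℝ := Pi.single ⟨0, by omega⟩ 1
  have hp : p ≠ 0 := by simp [p]
  have hs := energy_pos g he ((mem_inducedTarget_iff he (e x, p)).2 ⟨hq, hp⟩)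
  set s := energy g e (e x, p) with hs'
  refine ⟨e, he, (e x, √(t / s) • p), (mem_inducedTarget_iff he _).2
    ⟨hq, smul_ne_zero (Real.sqrt_ne_zero'.2 (by positivity)) hp⟩, ?_⟩
  have h1 : energy g e (e x, √(t / s) • p) = √(t / s) * √(t / s) * s := by
    rw [hs', energy_eq, energy_eq]
    simp only [Matrix.mulVec_smul, dotProduct_smul, smul_dotProduct, smul_eq_mul]
    ring
  rw [h1, Real.mul_self_sqrt (by positivity), div_mul_cancel₀ _ hs.ne']

end Metric

end NaturalCotangent

end

open NaturalCotangent in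
theorem theorem7 {n : ℕ} (hn : 2 ≤ n) {M : Type*} [TopologicalSpace M] [Nonempty M]
    [ChartedSpace (EuclideanSpace ℝ (Fin n)) M] [IsManifold (𝓡 n) ∞ M]
    (g : NaturalCotangent.Metric n M) (c : ℝ)
    (hc : NaturalCotangent.HasConstantSectionalCurvature g c)
    (A : ℝ) (lam mu : ℝ → ℝ)
    (hlam : ContDiffOn ℝ ∞ lam (Set.Ioi 0)) (hmu : ContDiffOn ℝ ∞ mu (Set.Ioi 0))
    (hA : 0 < A) (hlam_pos : ∀ t > 0, 0 < lam t)
    (hquot : ∀ t > 0, 0 < (2 * c - A ^ 2 * t * lam t ^ 2) / (lam t + 2 * t * deriv lam t))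
    (hmu_pos : ∀ t > 0, 0 < lam t + 2 * t * mu t) :
    NaturalCotangent.IsHermitianStructure (NaturalCotangent.natG g A c lam mu)
        (NaturalCotangent.natJ g A c lam) ∧
      (NaturalCotangent.IsKahlerStructure (NaturalCotangent.natG g A c lam mu)
        (NaturalCotangent.natJ g A c lam) ↔ ∀ t > 0, mu t = deriv lam t) ∧
      (∀ e ∈ IsManifold.maximalAtlas (𝓡 n) ∞ M,
        ∃ φ, NaturalCotangent.IsFundamentalForm (NaturalCotangent.inducedTarget e)
            (NaturalCotangent.natG g A c lam mu e) (NaturalCotangent.natJ g A c lam e) φ ∧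
          ∀ z ∈ NaturalCotangent.inducedTarget e, ∀ u v w,
            extDeriv φ z ![u, v, w] =
              (deriv lam (NaturalCotangent.energy g e z) - mu (NaturalCotangent.energy g e z)) *
                NaturalCotangent.threeForm g e z u v w) := by
  have hH : IsHermitianStructure (natG g A c lam mu) (natJ g A c lam) :=
    { transform_G := fun e he e' he' z hz hz' u v =>
        natG_inducedTransition g he he' hz.1 hz' A c lam mu u v
      transform_J := fun e he e' he' z hz hz' v =>
        natJ_inducedTransition g he he' hz.1 hz' A c lam v
      hermitian := fun e he =>
        isHermitianOn_natG_natJ g he hA hlam_pos hlam hmu hquot hc hmu_pos }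
  have hφ : ∀ e ∈ IsManifold.maximalAtlas (𝓡 n) ∞ M, IsFundamentalForm (inducedTarget e)
      (natG g A c lam mu e) (natJ g A c lam e) (fundamentalForm g lam mu e) :=
    fun e he => isFundamentalForm_fundamentalForm g he hA hlam_pos hlam hmu hquot
  refine ⟨hH, ⟨fun hK t ht => ?_, fun h => ⟨hH, fun e he => ⟨_, hφ e he, fun z hz => ?_⟩⟩⟩,
    fun e he => ⟨_, hφ e he, fun z hz => extDeriv_fundamentalForm g he hz hlam hmu⟩⟩
  · obtain ⟨e, he, z, hz, rfl⟩ := exists_energy_eq g hn ht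
    obtain ⟨φ, h1, h2⟩ := hK.closed e he
    obtain ⟨u, v, w, h3⟩ := exists_threeForm_ne_zero g hn he hz
    -- a fundamental form is determined by `G` and `J`
    have h4 : φ =ᶠ[nhds z] fundamentalForm g lam mu e := by
      filter_upwards [(isOpen_inducedTarget he).mem_nhds hz] with y hy
      exact ext_two fun u v => by rw [h1.2 y hy, (hφ e he).2 y hy]
    have h5 := extDeriv_fundamentalForm g he hz hlam hmu u v w
    rw [← h4.extDeriv_eq, h2 z hz] at h5
    have h6 := (mul_eq_zero.1 h5.symm).resolve_right h3
    linarith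
  · ext v
    have hv : v = ![v 0, v 1, v 2] := by
      ext i : 1; fin_cases i <;> rfl
    rw [hv, extDeriv_fundamentalForm g he hz hlam hmu, h _ (energy_pos g he hz), sub_self, zero_mul]
    rfl
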